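/- For a prime $p$ let $\left(\frac{\cdot}{p}\right)$ be the Legendre symbol and let $$Q_p(z)=\sum_{k=1}^{p-1}\left(\frac{k}{p}\right)z^k,\qquad F_p(z)=1+Q_p(z),\qquad F_p^{t}(z)=\sum_{k=0}^{p-1}\left(\frac{k+t}{p}\right)z^k\quad(t\in\mathbb Z)$$ be the Fekete polynomial, the modified Fekete polynomial and the shifted Fekete polynomials. Let $S^1$ be the unit circle with its normalized Lebesgue measure $dz$. A family of polynomials $(P_p)_{p\text{ prime}}$ is called $L^\alpha$-flat if, as $p\to\infty$ through the primes, * for $0<\alpha\le\infty$: $\big\|\,|P_p|-1\,\big\|_{L^\alpha(S^1,dz)}\to 0$; * for $\alpha=0$: the Mahler measures $M(P_p)=\exp\Big(\int_{S^1}\log|P_p(z)|\,dz\Big)$ tend to $1$. **Theorem.** For every $\alpha\in[0,\infty]$: 1. the normalized Fekete polynomials $Q_p/\sqrt p$ are not $L^\alpha$-flat; 2. the normalized modified Fekete polynomials $F_p/\sqrt p$ are not $L^\alpha$-flat; 3. for every choice of integers $t_p$ ($p$ prime), the normalized shifted Fekete polynomials $F_p^{t_p}/\sqrt p$ are not $L^\alpha$-flat.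 -/

import Mathlib

open scoped ENNReal

noncomputable section

/-- `L^α`-flatness, along the filter `l`, of a family `P` of polynomials, seen as functions on the
unit circle with its normalized Lebesgue measure (the circle is parametrized by `t ↦ e^{2πit}`).
For `0 < α ≤ ∞` it says that `‖ |P i| - 1 ‖_α → 0`; for `α = 0` it says that the Mahler measures
`exp (∫ log |P i|)` tend to `1`. -/
def IsFlat {ι : Type*} (l : Filter ι) (α : ℝ≥0∞) (P : ι → Polynomial ℂ) : Prop :=
  if α = 0 then
    Filter.Tendsto (fun i => (P i).mahlerMeasure) l (nhds 1)
  else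
    Filter.Tendsto
      (fun i => MeasureTheory.eLpNorm
        (fun t : AddCircle (1 : ℝ) => ‖(P i).eval (AddCircle.toCircle t : ℂ)‖ - 1) α
        AddCircle.haarAddCircle)
      l (nhds 0)

/-- The filter "`p → ∞` through the prime numbers". -/
def primesAtTop : Filter Nat.Primes :=
  Filter.comap (fun p : Nat.Primes => (p : ℕ)) Filter.atTop

/-- The Legendre symbol `(a / p)` as a complex number. -/
def legendreC (p : Nat.Primes) (a : ℤ) : ℂ :=
  haveI : Fact (p : ℕ).Prime := ⟨p.2⟩
  ((legendreSym (p : ℕ) a : ℤ) : ℂ)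

/-- The Fekete polynomial `Q_p(z) = ∑_{k=1}^{p-1} (k/p) z^k`. -/
def fekete (p : Nat.Primes) : Polynomial ℂ :=
  ∑ k ∈ Finset.Ico 1 (p : ℕ), Polynomial.C (legendreC p (k : ℤ)) * Polynomial.X ^ k

/-- The modified Fekete polynomial `F_p(z) = 1 + Q_p(z)`. -/
def modifiedFekete (p : Nat.Primes) : Polynomial ℂ :=
  1 + fekete p

/-- The shifted Fekete polynomial `F_p^t(z) = ∑_{k=0}^{p-1} ((k+t)/p) z^k`. -/
def shiftedFekete (p : Nat.Primes) (t : ℤ) : Polynomial ℂ :=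
  ∑ k ∈ Finset.range (p : ℕ), Polynomial.C (legendreC p ((k : ℤ) + t)) * Polynomial.X ^ k

/-- Normalization of a polynomial by the factor `1 / √p`. -/
def normalizeSqrt (p : Nat.Primes) (P : Polynomial ℂ) : Polynomial ℂ :=
  Polynomial.C (((Real.sqrt ((p : ℕ) : ℝ))⁻¹ : ℝ) : ℂ) * P

end

/-!
Flatness in any of the senses `α ∈ [0, ∞]` is reduced to one statement. The polynomials `P`
considered have `L²` norm at most `1` (Parseval). If `α > 0`, flatness gives `|P| → 1` in measure,
and if `α = 0`, Jensen's inequality bounds the Mahler measure by the `L¹` norm; in both cases the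
`L¹` norm tends to `1` (`IsFlat.tendsto_integral_normOnCircle`). As the `L²` norm is at most `1`,
this forces `‖ |P|² - 1 ‖₁ → 0` (`integral_abs_normOnCircle_sq_sub_one_le`). The modified Fekete
polynomials differ from the Fekete polynomials by `1 / √p` after normalization, and the Fekete
polynomials are the shifted ones with shift `0`, so it remains to bound `‖ |P|² - 1 ‖₁` from below
for the shifted Fekete polynomials, uniformly in the shift.

By the Gauss sum evaluation, the value of the normalized polynomial at `e ((θ + j) / p)`, where
`e u = e ^ (2 π i u)`, has the modulus of `∑ m, χ (m - j) b m` (`norm_sq_eval_shiftedFekete`); here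
`χ` is the Legendre symbol and `b m` is a Dirichlet kernel that is large only for `m` near `0`,
times a phase depending on the shift. On averaging `|∑ m, χ (m - j) b m|²` over `j` against the
signs `χ (a - j) χ (a' - j)`, the main term is `2 Re (b a * conj (b a'))`, because the other
fourth order correlations of `χ` are `O(p ^ (3 / 4))` while `∑ |b m| = O(log p)`; were the squared
moduli close to `1`, the average would be small (`le_sum_abs_sq_norm_sub_one`). Up to positive
factors bounded below and up to sign, the main term is `cos φ` for `(a, a') = (0, -1)` and
`cos (2 φ)` for `(a, a') = (1, -1)`, with an angle `φ` that depends on the shift; the two cosines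
are never both small (`exists_interpKernel_correlation`).

The bound for the correlations does not need Weil's theorem (`abs_quadCorr_le`). An inversion turns
a fourth order correlation into a sum `∑ y, χ (f y)` over a cubic `f`. The fourth moment of these
sums over all `q⁴` cubics is at most `3 q⁶`, because only quadruples of points that pair off
contribute. The cubics `γ f (α Y + β)` all have the same modulus of the sum, and at least `q (q - 1)² / 9`
of them are distinct; hence `|∑ y, χ (f y)|⁴ = O(q³)`.
-/

/-! ### The quadratic character of a finite field: cubic sums -/

section QuadraticCharacterSums

variable {F : Type*} [Field F] [Fintype F] [DecidableEq F]

/-- The value at `y` of the cubic polynomial with coefficients `c`, constant term first. -/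
def cubicEval (c : F × F × F × F) (y : F) : F :=
  c.1 + c.2.1 * y + c.2.2.1 * y ^ 2 + c.2.2.2 * y ^ 3

/-- The sum of the quadratic character over the values of a cubic polynomial. -/
def cubicCharSum (c : F × F × F × F) : ℤ :=
  ∑ y : F, quadraticChar F (cubicEval c y)

lemma abs_quadraticChar_le_one (a : F) : |quadraticChar F a| ≤ 1 := by
  rcases eq_or_ne a 0 with rfl | h
  · simp
  · rcases quadraticChar_dichotomy h with h | h <;> simp [h]

lemma sum_quadraticChar_add_mul (hF : ringChar F ≠ 2) (a : F) {b : F} (hb : b ≠ 0) :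
    ∑ x : F, quadraticChar F (a + x * b) = 0 := by
  rw [← quadraticChar_sum_zero hF]
  exact Fintype.sum_equiv ((Equiv.mulRight₀ b hb).trans (Equiv.addLeft a)) _ _ fun x => rfl

/-- If `y` differs from `u`, `v`, `w`, the values at `y` of the cubic polynomials with prescribed
values at `u`, `v`, `w` are equidistributed, so that the character sum over all cubics vanishes. -/
lemma sum_cubic_prod_eq_zero (hF : ringChar F ≠ 2) {y u v w : F} (hu : y ≠ u) (hv : y ≠ v)
    (hw : y ≠ w) :
    ∑ c : F × F × F × F, quadraticChar F (cubicEval c y) * quadraticChar F (cubicEval c u) *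
      quadraticChar F (cubicEval c v) * quadraticChar F (cubicEval c w) = 0 := by
  -- `h` is the coefficient vector of `(Y - u) (Y - v) (Y - w)`
  let h : F × F × F × F := (-(u * v * w), u * v + v * w + u * w, -(u + v + w), 1)
  have hy : ∀ (c : F × F × F × F) (r z : F), cubicEval (c + r • h) z =
      cubicEval c z + r * ((z - u) * (z - v) * (z - w)) := by
    intro c r z; simp [cubicEval, h]; ring
  have hyne : (y - u) * (y - v) * (y - w) ≠ 0 :=
    mul_ne_zero (mul_ne_zero (sub_ne_zero.2 hu) (sub_ne_zero.2 hv)) (sub_ne_zero.2 hw)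
  set G : F × F × F × F → ℤ := fun c => quadraticChar F (cubicEval c y) *
    quadraticChar F (cubicEval c u) * quadraticChar F (cubicEval c v) *
    quadraticChar F (cubicEval c w) with hG
  have h1 : ∀ r : F, ∑ c, G (c + r • h) = ∑ c, G c := fun r =>
    Fintype.sum_equiv (Equiv.addRight (r • h)) _ _ fun x => rfl
  have h2 : (Fintype.card F : ℤ) * ∑ c, G c = 0 := by
    calc (Fintype.card F : ℤ) * ∑ c, G c = ∑ r : F, ∑ c, G (c + r • h) := by
          simp [h1]
      _ = ∑ c, ∑ r : F, G (c + r • h) := Finset.sum_comm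
      _ = 0 := by
          refine Finset.sum_eq_zero fun c _ => ?_
          simp only [hG, hy, sub_self, zero_mul, mul_zero, add_zero]
          rw [← Finset.sum_mul, ← Finset.sum_mul, ← Finset.sum_mul,
            sum_quadraticChar_add_mul hF _ hyne]
          simp
  exact (mul_eq_zero.1 h2).resolve_left (by exact_mod_cast Fintype.card_ne_zero)

set_option maxHeartbeats 400000 in
/-- Fourth moment of the cubic sums: only the quadruples of points that pair off contribute. -/
lemma sum_cubicCharSum_pow_four_le (hF : ringChar F ≠ 2) :
    ∑ c : F × F × F × F, cubicCharSum c ^ 4 ≤ 3 * (Fintype.card F : ℤ) ^ 6 := by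
  set q : ℤ := (Fintype.card F : ℤ) with hq
  set χ := quadraticChar F
  have hexp : ∀ c : F × F × F × F, cubicCharSum c ^ 4 = ∑ a : F, ∑ b : F, ∑ d : F, ∑ e : F,
      χ (cubicEval c a) * χ (cubicEval c b) * χ (cubicEval c d) * χ (cubicEval c e) := by
    intro c
    simp only [← Finset.mul_sum, ← Finset.sum_mul]
    simp only [cubicCharSum, χ]
    ring
  have hbound : ∀ a b d e : F, ∑ c : F × F × F × F,
      χ (cubicEval c a) * χ (cubicEval c b) * χ (cubicEval c d) * χ (cubicEval c e) ≤
      q ^ 4 * ((if a = b ∧ d = e then 1 else 0) + (if a = d ∧ b = e then 1 else 0) +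
        (if a = e ∧ b = d then 1 else 0)) := by
    intro a b d e
    have hq4 : 0 ≤ q ^ 4 := by positivity
    by_cases hp : (a = b ∧ d = e) ∨ (a = d ∧ b = e) ∨ (a = e ∧ b = d)
    · have h1 : ∑ c : F × F × F × F,
          χ (cubicEval c a) * χ (cubicEval c b) * χ (cubicEval c d) * χ (cubicEval c e) ≤ q ^ 4 := by
        calc _ ≤ ∑ c : F × F × F × F, (1 : ℤ) := by
              refine Finset.sum_le_sum fun c _ => (le_abs_self _).trans ?_
              rw [abs_mul, abs_mul, abs_mul]
              have := fun z => abs_quadraticChar_le_one (cubicEval c z)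
              exact mul_le_one₀ (mul_le_one₀ (mul_le_one₀ (this a) (abs_nonneg _) (this b))
                (abs_nonneg _) (this d)) (abs_nonneg _) (this e)
          _ = q ^ 4 := by simp [hq, Fintype.card_prod]; ring
      refine h1.trans (le_mul_of_one_le_right hq4 ?_)
      rcases hp with h | h | h <;> simp only [h, and_self, if_true] <;> split_ifs <;> norm_num
    · have h0 : ∑ c : F × F × F × F,
          χ (cubicEval c a) * χ (cubicEval c b) * χ (cubicEval c d) * χ (cubicEval c e) = 0 := by
        have hcase : (a ≠ b ∧ a ≠ d ∧ a ≠ e) ∨ (b ≠ a ∧ b ≠ d ∧ b ≠ e) ∨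
            (d ≠ a ∧ d ≠ b ∧ d ≠ e) ∨ (e ≠ a ∧ e ≠ b ∧ e ≠ d) := by grind
        rcases hcase with h | h | h | h <;>
          rw [← sum_cubic_prod_eq_zero hF h.1 h.2.1 h.2.2] <;>
          exact Finset.sum_congr rfl fun c _ => by ring
      rw [h0]
      exact mul_nonneg hq4 (by split_ifs <;> norm_num)
  calc ∑ c : F × F × F × F, cubicCharSum c ^ 4
      = ∑ a : F, ∑ b : F, ∑ d : F, ∑ e : F, ∑ c : F × F × F × F,
          χ (cubicEval c a) * χ (cubicEval c b) * χ (cubicEval c d) * χ (cubicEval c e) := by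
        simp only [hexp]
        rw [Finset.sum_comm]
        refine Finset.sum_congr rfl fun a _ => ?_
        rw [Finset.sum_comm]
        refine Finset.sum_congr rfl fun b _ => ?_
        rw [Finset.sum_comm]
        refine Finset.sum_congr rfl fun d _ => ?_
        rw [Finset.sum_comm]
    _ ≤ ∑ a : F, ∑ b : F, ∑ d : F, ∑ e : F,
          q ^ 4 * ((if a = b ∧ d = e then 1 else 0) + (if a = d ∧ b = e then 1 else 0) +
            (if a = e ∧ b = d then 1 else 0)) := by
        gcongr with a _ b _ d _ e _
        exact hbound a b d e
    _ = 3 * q ^ 6 := by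
        simp only [← Finset.mul_sum, Finset.sum_add_distrib, ite_and]
        simp [Finset.sum_ite_eq, ← hq]
        ring

/-- The coefficients of the cubic `γ f (α Y + β)`, for `f = (1 + B Y) (1 + M Y) (1 + N Y)`. -/
def affineCubic (B M N α β γ : F) : F × F × F × F :=
  (γ * ((1 + B * β) * (1 + M * β) * (1 + N * β)),
    γ * α * (B * (1 + M * β) * (1 + N * β) + M * (1 + B * β) * (1 + N * β) +
      N * (1 + B * β) * (1 + M * β)),
    γ * α ^ 2 * (B * M * (1 + N * β) + B * N * (1 + M * β) + M * N * (1 + B * β)),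
    γ * α ^ 3 * (B * M * N))

lemma cubicEval_affineCubic (B M N α β γ y : F) :
    cubicEval (affineCubic B M N α β γ) y =
      γ * ((1 + B * (α * y + β)) * (1 + M * (α * y + β)) * (1 + N * (α * y + β))) := by
  simp only [cubicEval, affineCubic]; ring

lemma cubicCharSum_affineCubic (B M N : F) (α : Fˣ) (β : F) (γ : Fˣ) :
    cubicCharSum (affineCubic B M N α β γ) =
      quadraticChar F γ * cubicCharSum (affineCubic B M N 1 0 1) := by
  simp only [cubicCharSum, cubicEval_affineCubic, Finset.mul_sum]
  refine Fintype.sum_equiv ((Equiv.mulLeft₀ (α : F) α.ne_zero).trans (Equiv.addRight β)) _ _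
    fun y => ?_
  simp [map_mul]

/-- At most nine affine substitutions lead to the same cubic: a substitution is determined by the
roots to which it moves two of the roots of that cubic. -/
lemma card_affineCubic_fiber_le {B M N : F} (hB : B ≠ 0) (hM : M ≠ 0) (hN : N ≠ 0) (hBM : B ≠ M)
    (c : F × F × F × F) :
    (Finset.univ.filter fun x : Fˣ × F × Fˣ => affineCubic B M N x.1 x.2.1 x.2.2 = c).card ≤ 9 := by
  classical
  set S := Finset.univ.filter fun x : Fˣ × F × Fˣ => affineCubic B M N x.1 x.2.1 x.2.2 = c with hS
  rcases S.eq_empty_or_nonempty with h | ⟨⟨α₀, β₀, γ₀⟩, h0⟩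
  · simp [h]
  let R : Finset F := {-B⁻¹, -M⁻¹, -N⁻¹}
  have hR : R.card ≤ 3 := Finset.card_le_three
  have hmem : ∀ z : F, (1 + B * z) * (1 + M * z) * (1 + N * z) = 0 → z ∈ R := by
    intro z hz
    simp only [R, Finset.mem_insert, Finset.mem_singleton]
    rcases mul_eq_zero.1 hz with h | h
    · rcases mul_eq_zero.1 h with h | h
      · left; field_simp; linear_combination h
      · right; left; field_simp; linear_combination h
    · right; right; field_simp; linear_combination h
  have hα₀ : (α₀ : F) ≠ 0 := α₀.ne_zero
  -- `z₁`, `z₂` are two distinct roots of the common cubic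
  set z₁ : F := (-B⁻¹ - β₀) / α₀ with hz₁
  set z₂ : F := (-M⁻¹ - β₀) / α₀ with hz₂
  have hz : z₁ ≠ z₂ := by
    intro h
    rw [hz₁, hz₂, div_left_inj' hα₀, sub_left_inj, neg_inj] at h
    exact hBM (inv_injective h)
  have h0' : affineCubic B M N α₀ β₀ γ₀ = c := by simpa [hS] using h0
  have hr₁ : cubicEval c z₁ = 0 := by
    rw [← h0', cubicEval_affineCubic, hz₁, mul_div_cancel₀ _ hα₀, sub_add_cancel]
    simp [hB]
  have hr₂ : cubicEval c z₂ = 0 := by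
    rw [← h0', cubicEval_affineCubic, hz₂, mul_div_cancel₀ _ hα₀, sub_add_cancel]
    simp [hM]
  have hroot : ∀ x ∈ S, ∀ z, cubicEval c z = 0 → (x.1 : F) * z + x.2.1 ∈ R := by
    intro x hx z hz
    have hx' : affineCubic B M N x.1 x.2.1 x.2.2 = c := by simpa [hS] using hx
    rw [← hx', cubicEval_affineCubic] at hz
    exact hmem _ ((mul_eq_zero.1 hz).resolve_left x.2.2.ne_zero)
  calc S.card ≤ (R ×ˢ R).card := by
        refine Finset.card_le_card_of_injOn
          (fun x => ((x.1 : F) * z₁ + x.2.1, (x.1 : F) * z₂ + x.2.1)) ?_ ?_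
        · intro x hx
          exact Finset.mem_product.2 ⟨hroot x hx _ hr₁, hroot x hx _ hr₂⟩
        · rintro ⟨α, β, γ⟩ hx ⟨α', β', γ'⟩ hx' heq
          simp only [Prod.mk.injEq] at heq
          obtain ⟨h1, h2⟩ := heq
          have hα : (α : F) = α' := by
            have : ((α : F) - α') * (z₁ - z₂) = 0 := by linear_combination h1 - h2
            exact sub_eq_zero.1 ((mul_eq_zero.1 this).resolve_right (sub_ne_zero.2 hz))
          have hβ : β = β' := by rw [hα] at h1; exact add_left_cancel h1
          have hγ : (γ : F) = γ' := by
            have e : affineCubic B M N α β γ = c := by simpa [hS] using hx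
            have e' : affineCubic B M N α' β' γ' = c := by simpa [hS] using hx'
            have := congrArg (fun c => c.2.2.2) (e.trans e'.symm)
            simp only [affineCubic, hα] at this
            have hne : (α' : F) ^ 3 * (B * M * N) ≠ 0 :=
              mul_ne_zero (pow_ne_zero _ α'.ne_zero) (mul_ne_zero (mul_ne_zero hB hM) hN)
            exact mul_right_cancel₀ hne (by linear_combination this)
          simp only [Prod.mk.injEq]
          exact ⟨Units.ext hα, hβ, Units.ext hγ⟩
    _ = R.card * R.card := Finset.card_product _ _
    _ ≤ 3 * 3 := Nat.mul_le_mul hR hR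

/-- A nontrivial bound for cubic sums: the fourth moment over all cubics dominates the contribution
of the `q (q - 1)²` affine substitutions, along which the modulus of the sum is constant. -/
lemma cubicCharSum_pow_four_le (hF : ringChar F ≠ 2) {B M N : F} (hB : B ≠ 0) (hM : M ≠ 0)
    (hN : N ≠ 0) (hBM : B ≠ M) :
    cubicCharSum (affineCubic B M N 1 0 1) ^ 4 ≤ 108 * (Fintype.card F : ℤ) ^ 3 := by
  classical
  set q : ℤ := (Fintype.card F : ℤ) with hq
  set T := cubicCharSum (affineCubic B M N 1 0 1) with hT
  have hq2 : 2 ≤ q := by rw [hq]; exact_mod_cast Fintype.one_lt_card (α := F)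
  have hconst : ∀ x : Fˣ × F × Fˣ, cubicCharSum (affineCubic B M N x.1 x.2.1 x.2.2) ^ 4 = T ^ 4 := by
    intro x
    rw [cubicCharSum_affineCubic, mul_pow, show (4 : ℕ) = 2 * 2 from rfl, pow_mul,
      quadraticChar_sq_one x.2.2.ne_zero]
    simp [hT]
  have hcard : (Fintype.card (Fˣ × F × Fˣ) : ℤ) = (q - 1) ^ 2 * q := by
    rw [Fintype.card_prod, Fintype.card_prod, Fintype.card_units]
    push_cast [Nat.cast_sub (Fintype.card_pos (α := F))]
    ring
  have h1 : (q - 1) ^ 2 * q * T ^ 4 ≤ 9 * (3 * q ^ 6) := by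
    calc (q - 1) ^ 2 * q * T ^ 4
        = ∑ x : Fˣ × F × Fˣ, cubicCharSum (affineCubic B M N x.1 x.2.1 x.2.2) ^ 4 := by
          simp only [hconst, Finset.sum_const, Finset.card_univ, nsmul_eq_mul, hcard]
      _ = ∑ c : F × F × F × F, ((Finset.univ.filter fun x : Fˣ × F × Fˣ =>
            affineCubic B M N x.1 x.2.1 x.2.2 = c).card : ℤ) * cubicCharSum c ^ 4 := by
          rw [← Finset.sum_fiberwise (s := Finset.univ)
            (g := fun x : Fˣ × F × Fˣ => affineCubic B M N (x.1 : F) x.2.1 x.2.2)]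
          refine Finset.sum_congr rfl fun c _ => ?_
          rw [Finset.sum_congr rfl (g := fun _ => cubicCharSum c ^ 4)]
          · simp
          · intro x hx; rw [(Finset.mem_filter.1 hx).2]
      _ ≤ ∑ c : F × F × F × F, 9 * cubicCharSum c ^ 4 := by
          refine Finset.sum_le_sum fun c _ => ?_
          refine mul_le_mul_of_nonneg_right ?_ (Even.pow_nonneg (by decide) _)
          exact_mod_cast card_affineCubic_fiber_le hB hM hN hBM c
      _ ≤ 9 * (3 * q ^ 6) := by
          rw [← Finset.mul_sum]
          exact mul_le_mul_of_nonneg_left (sum_cubicCharSum_pow_four_le hF) (by norm_num)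
  have hT4 : 0 ≤ T ^ 4 := Even.pow_nonneg (by decide) _
  have h2 : q ^ 2 ≤ 4 * (q - 1) ^ 2 := by nlinarith
  have h3 : q ^ 3 * T ^ 4 ≤ q ^ 3 * (108 * q ^ 3) := by
    calc q ^ 3 * T ^ 4 = q ^ 2 * (q * T ^ 4) := by ring
      _ ≤ 4 * (q - 1) ^ 2 * (q * T ^ 4) :=
          mul_le_mul_of_nonneg_right h2 (mul_nonneg (by linarith) hT4)
      _ ≤ q ^ 3 * (108 * q ^ 3) := by nlinarith [h1]
  exact le_of_mul_le_mul_left h3 (by positivity)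

/-- Inversion in a sum over the nonzero elements of a finite field. -/
lemma sum_erase_zero_inv (f : F → ℤ) :
    ∑ x ∈ Finset.univ.erase (0 : F), f x⁻¹ = ∑ x ∈ Finset.univ.erase (0 : F), f x := by
  refine Finset.sum_nbij' (fun x => x⁻¹) (fun x => x⁻¹) ?_ ?_ ?_ ?_ ?_ <;> simp

lemma quadraticChar_mul_self {a : F} (ha : a ≠ 0) : quadraticChar F a * quadraticChar F a = 1 := by
  rw [← sq, quadraticChar_sq_one ha]

/-- The autocorrelations of the quadratic character. -/
lemma sum_quadraticChar_sub_mul_sub (hF : ringChar F ≠ 2) {a b : F} (hab : a ≠ b) :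
    ∑ x : F, quadraticChar F (a - x) * quadraticChar F (b - x) = -1 := by
  set χ := quadraticChar F
  have h1 : ∑ x : F, χ (a - x) * χ (b - x) = ∑ x : F, χ x * χ (x + (b - a)) :=
    Fintype.sum_equiv (Equiv.subLeft a) _ _ fun x => by simp
  rw [h1, ← Finset.add_sum_erase _ _ (Finset.mem_univ (0 : F))]
  simp only [χ, MulChar.map_zero, zero_mul, zero_add]
  have h2 : ∀ x ∈ Finset.univ.erase (0 : F), χ x * χ (x + (b - a)) = χ (1 + x⁻¹ * (b - a)) := by
    intro x hx
    have hx0 : x ≠ 0 := (Finset.mem_erase.1 hx).1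
    rw [show x + (b - a) = x * (1 + x⁻¹ * (b - a)) by field_simp, map_mul, ← mul_assoc,
      quadraticChar_mul_self hx0, one_mul]
  rw [Finset.sum_congr rfl h2, sum_erase_zero_inv fun x => χ (1 + x * (b - a))]
  have h3 := sum_quadraticChar_add_mul hF 1 (sub_ne_zero.2 hab.symm)
  rw [← Finset.add_sum_erase _ _ (Finset.mem_univ (0 : F))] at h3
  simp only [zero_mul, add_zero, MulChar.map_one] at h3
  linarith

/-- The fourth order correlation of the quadratic character. -/
def quadCorr (a b m n : F) : ℤ :=
  ∑ x : F, quadraticChar F (a - x) * quadraticChar F (b - x) *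
    (quadraticChar F (m - x) * quadraticChar F (n - x))

/-- The inversion `x ↦ 1 / x`, centred at `a`, turns a fourth order correlation into a cubic
sum. -/
lemma quadCorr_eq_cubicCharSum (a b m n : F) :
    quadCorr a b m n = cubicCharSum (affineCubic (b - a) (m - a) (n - a) 1 0 1) - 1 := by
  set χ := quadraticChar F
  have h1 : quadCorr a b m n =
      ∑ x : F, χ x * χ (x + (b - a)) * (χ (x + (m - a)) * χ (x + (n - a))) :=
    Fintype.sum_equiv (Equiv.subLeft a) _ _ fun x => by simp [χ]
  let f : F → ℤ := fun y => χ ((1 + (b - a) * y) * (1 + (m - a) * y) * (1 + (n - a) * y))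
  rw [h1, ← Finset.add_sum_erase _ _ (Finset.mem_univ (0 : F))]
  simp only [χ, MulChar.map_zero, zero_mul, zero_add]
  have h2 : ∀ x ∈ Finset.univ.erase (0 : F),
      χ x * χ (x + (b - a)) * (χ (x + (m - a)) * χ (x + (n - a))) = f x⁻¹ := by
    intro x hx
    have hx0 : x ≠ 0 := (Finset.mem_erase.1 hx).1
    have h4 : χ x * χ x * (χ x * χ x) = 1 := by
      rw [show χ x * χ x = 1 from quadraticChar_mul_self hx0, mul_one]
    have e : ∀ d : F, χ (x + d) = χ x * χ (1 + d * x⁻¹) := by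
      intro d; rw [← map_mul]; congr 1; field_simp
    simp only [e, f, map_mul]
    linear_combination (χ (1 + (b - a) * x⁻¹) * χ (1 + (m - a) * x⁻¹) * χ (1 + (n - a) * x⁻¹)) * h4
  rw [Finset.sum_congr rfl h2, sum_erase_zero_inv f]
  have h3 : cubicCharSum (affineCubic (b - a) (m - a) (n - a) 1 0 1) = ∑ y, f y := by
    simp [cubicCharSum, cubicEval_affineCubic, f, χ]
  rw [h3, ← Finset.add_sum_erase _ _ (Finset.mem_univ (0 : F))]
  simp [f, χ]

/-- Fourth order correlations are `O(q ^ (3 / 4))`, unless the four points pair off. -/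
lemma abs_quadCorr_le (hF : ringChar F ≠ 2) {a b m n : F} (hab : a ≠ b)
    (h : ¬ ((m = a ∧ n = b) ∨ (m = b ∧ n = a))) :
    (|quadCorr a b m n| : ℝ) ≤ 5 * (Fintype.card F : ℝ) ^ (3 / 4 : ℝ) := by
  have hq1 : (1 : ℝ) ≤ (Fintype.card F : ℝ) ^ (3 / 4 : ℝ) :=
    Real.one_le_rpow (by exact_mod_cast Fintype.card_pos (α := F)) (by norm_num)
  have habs := fun z : F => abs_quadraticChar_le_one z
  -- two of the four points coincide, the other two are distinct
  have key : ∀ u v w : F, u ≠ v → (|∑ x : F, quadraticChar F (u - x) * quadraticChar F (v - x) *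
      (quadraticChar F (w - x) * quadraticChar F (w - x))| : ℤ) ≤ 2 := by
    intro u v w huv
    have e : ∑ x : F, quadraticChar F (u - x) * quadraticChar F (v - x) *
        (quadraticChar F (w - x) * quadraticChar F (w - x)) =
        -1 - quadraticChar F (u - w) * quadraticChar F (v - w) := by
      rw [← sum_quadraticChar_sub_mul_sub hF huv,
        ← Finset.add_sum_erase _ _ (Finset.mem_univ w), ← Finset.add_sum_erase Finset.univ
        (fun x => quadraticChar F (u - x) * quadraticChar F (v - x)) (Finset.mem_univ w)]
      rw [sub_self, MulChar.map_zero, mul_zero, mul_zero, zero_add, add_sub_cancel_left]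
      refine Finset.sum_congr rfl fun x hx => ?_
      rw [quadraticChar_mul_self (sub_ne_zero.2 (Finset.mem_erase.1 hx).1.symm), mul_one]
    rw [e]
    have := abs_mul (quadraticChar F (u - w)) (quadraticChar F (v - w))
    have h2 := mul_le_one₀ (habs (u - w)) (abs_nonneg _) (habs (v - w))
    rw [← this, abs_le] at h2
    rw [abs_le]; constructor <;> linarith [h2.1, h2.2]
  have key' : (|quadCorr a b m n| : ℤ) ≤ 2 →
      (|quadCorr a b m n| : ℝ) ≤ 5 * (Fintype.card F : ℝ) ^ (3 / 4 : ℝ) := by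
    intro h2
    have : (|quadCorr a b m n| : ℝ) ≤ 2 := by exact_mod_cast h2
    linarith
  have swap : ∀ u v w : F, (∀ x, quadraticChar F (a - x) * quadraticChar F (b - x) *
      (quadraticChar F (m - x) * quadraticChar F (n - x)) =
      quadraticChar F (u - x) * quadraticChar F (v - x) *
      (quadraticChar F (w - x) * quadraticChar F (w - x))) → u ≠ v →
      (|quadCorr a b m n| : ℝ) ≤ 5 * (Fintype.card F : ℝ) ^ (3 / 4 : ℝ) := by
    intro u v w he huv
    apply key'
    rw [quadCorr, Finset.sum_congr rfl fun x _ => he x]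
    exact key u v w huv
  by_cases hmn : m = n
  · exact swap a b m (fun x => by rw [hmn]) hab
  by_cases hma : m = a
  · exact swap b n a (fun x => by rw [hma]; ring) (by grind)
  by_cases hmb : m = b
  · exact swap a n b (fun x => by rw [hmb]; ring) (by grind)
  by_cases hna : n = a
  · exact swap b m a (fun x => by rw [hna]; ring) (by grind)
  by_cases hnb : n = b
  · exact swap a m b (fun x => by rw [hnb]; ring) (by grind)
  have h4 := cubicCharSum_pow_four_le hF (sub_ne_zero.2 (Ne.symm hab)) (sub_ne_zero.2 hma)
    (sub_ne_zero.2 hna) (fun e => hmb (sub_left_injective e).symm)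
  rw [quadCorr_eq_cubicCharSum]
  set T := cubicCharSum (affineCubic (b - a) (m - a) (n - a) 1 0 1)
  set q : ℝ := (Fintype.card F : ℝ) with hq
  have h5 : |(T : ℝ)| ^ 4 ≤ (4 * q ^ (3 / 4 : ℝ)) ^ 4 := by
    have e : (q ^ (3 / 4 : ℝ)) ^ 4 = q ^ 3 := by
      rw [← Real.rpow_natCast, ← Real.rpow_mul (by positivity), ← Real.rpow_natCast]; norm_num
    have h4' : (T : ℝ) ^ 4 ≤ 108 * q ^ 3 := by rw [hq]; exact_mod_cast h4
    rw [mul_pow, e, Even.pow_abs (by decide)]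
    have : 0 ≤ q ^ 3 := by positivity
    linarith
  have h6 : |(T : ℝ)| ≤ 4 * q ^ (3 / 4 : ℝ) := le_of_pow_le_pow_left₀ (by norm_num) (by positivity) h5
  push_cast
  calc |(T : ℝ) - 1| ≤ |(T : ℝ)| + |(1 : ℝ)| := abs_sub _ _
    _ ≤ 5 * q ^ (3 / 4 : ℝ) := by rw [abs_one]; linarith

end QuadraticCharacterSums

/-! ### Testing the squared modulus against a short correlation -/

section QuadraticCharacterSums

variable {F : Type*} [Field F] [Fintype F] [DecidableEq F]

lemma quadCorr_self (a b : F) (hab : a ≠ b) : quadCorr a b a b = (Fintype.card F : ℤ) - 2 := by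
  have h : ∀ x : F, quadraticChar F (a - x) * quadraticChar F (b - x) *
      (quadraticChar F (a - x) * quadraticChar F (b - x)) =
      1 - (if a = x then 1 else 0) - (if b = x then 1 else 0) := by
    intro x
    by_cases h1 : a = x
    · have : b ≠ x := fun h => hab (h1.trans h.symm)
      simp [h1, this]
    by_cases h2 : b = x
    · simp [h1, h2]
    · rw [mul_mul_mul_comm, quadraticChar_mul_self (sub_ne_zero.2 h1),
        quadraticChar_mul_self (sub_ne_zero.2 h2)]
      simp [h1, h2]
  simp only [quadCorr, h, Finset.sum_sub_distrib]
  simp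
  ring

lemma quadCorr_swap_right (a b m n : F) : quadCorr a b m n = quadCorr a b n m := by
  simp only [quadCorr]
  exact Finset.sum_congr rfl fun x _ => by ring

/-- The translates `∑ m, χ (m - j) * b m` cannot all have modulus close to `1` when `b a` and
`b a'` are correlated: this shows on testing against `χ (a - j) * χ (a' - j)`. -/
lemma le_sum_abs_sq_norm_sub_one (hF : ringChar F ≠ 2) (b : F → ℂ) {a a' : F} (haa : a ≠ a') :
    2 * ((Fintype.card F : ℝ) - 2) * |(b a * (starRingEnd ℂ) (b a')).re| -
        5 * (Fintype.card F : ℝ) ^ (3 / 4 : ℝ) * (∑ m, ‖b m‖) ^ 2 - 1 ≤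
      ∑ j : F, |‖∑ m, (quadraticChar F (m - j) : ℂ) * b m‖ ^ 2 - 1| := by
  set q : ℝ := (Fintype.card F : ℝ) with hq
  have hq2 : 2 ≤ q := by rw [hq]; exact_mod_cast Fintype.one_lt_card (α := F)
  let Φ : F → ℤ := fun j => quadraticChar F (a - j) * quadraticChar F (a' - j)
  let v : F → ℂ := fun j => ∑ m, (quadraticChar F (m - j) : ℂ) * b m
  have hΦ : ∀ j, |(Φ j : ℝ)| ≤ 1 := by
    intro j
    have : |Φ j| ≤ 1 := by
      rw [abs_mul]
      exact mul_le_one₀ (abs_quadraticChar_le_one _) (abs_nonneg _) (abs_quadraticChar_le_one _)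
    exact_mod_cast this
  have hΦsum : ∑ j, (Φ j : ℝ) = -1 := by
    exact_mod_cast sum_quadraticChar_sub_mul_sub hF haa
  have hexp : (∑ j, (Φ j : ℝ) * ‖v j‖ ^ 2 : ℝ) =
      ∑ m, ∑ n, (quadCorr a a' m n : ℂ) * (b m * (starRingEnd ℂ) (b n)) := by
    push_cast
    have : ∀ j, (Φ j : ℂ) * (‖v j‖ : ℂ) ^ 2 = ∑ m, ∑ n, ((Φ j *
        (quadraticChar F (m - j) * quadraticChar F (n - j)) : ℤ) : ℂ) *
        (b m * (starRingEnd ℂ) (b n)) := by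
      intro j
      rw [← Complex.mul_conj', map_sum, Finset.sum_mul_sum, Finset.mul_sum]
      refine Finset.sum_congr rfl fun m _ => ?_
      rw [Finset.mul_sum]
      refine Finset.sum_congr rfl fun n _ => ?_
      push_cast
      rw [map_mul, map_intCast]
      ring
    simp only [this]
    rw [Finset.sum_comm]
    refine Finset.sum_congr rfl fun m _ => ?_
    rw [Finset.sum_comm]
    refine Finset.sum_congr rfl fun n _ => ?_
    rw [← Finset.sum_mul, quadCorr]
    simp only [Φ]
    push_cast
    rfl
  -- the part of the correlation that does not come from `{m, n} = {a, a'}`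
  let w : F → F → ℝ := fun m n => (quadCorr a a' m n : ℝ) -
    ((if m = a ∧ n = a' then q - 2 else 0) + (if m = a' ∧ n = a then q - 2 else 0))
  have hw : ∀ m n, |w m n| ≤ 5 * q ^ (3 / 4 : ℝ) := by
    intro m n
    have h0 : (0 : ℝ) ≤ 5 * q ^ (3 / 4 : ℝ) := by positivity
    by_cases h1 : m = a ∧ n = a'
    · have h2 : ¬ (m = a' ∧ n = a) := fun h => haa (h1.1.symm.trans h.1)
      simp only [w, h1.1, h1.2, quadCorr_self a a' haa, and_self, if_true]
      rw [if_neg (fun h => haa h.1)]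
      simpa [hq] using h0
    by_cases h2 : m = a' ∧ n = a
    · simp only [w, h2.1, h2.2, quadCorr_swap_right a a' a' a, quadCorr_self a a' haa, and_self,
        if_true]
      rw [if_neg (fun h => haa h.2)]
      simpa [hq] using h0
    · simp only [w, if_neg h1, if_neg h2, add_zero, sub_zero]
      exact abs_quadCorr_le hF haa (fun h => h.elim h1 h2)
  have hsplit : ∑ m, ∑ n, (quadCorr a a' m n : ℂ) * (b m * (starRingEnd ℂ) (b n)) =
      ∑ m, ∑ n, (w m n : ℂ) * (b m * (starRingEnd ℂ) (b n)) +
        ((2 * (q - 2) * (b a * (starRingEnd ℂ) (b a')).re : ℝ) : ℂ) := by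
    have e : ∀ m n, (quadCorr a a' m n : ℂ) * (b m * (starRingEnd ℂ) (b n)) =
        (w m n : ℂ) * (b m * (starRingEnd ℂ) (b n)) +
        (if m = a then (if n = a' then ((q - 2 : ℝ) : ℂ) * (b m * (starRingEnd ℂ) (b n)) else 0)
          else 0) +
        (if m = a' then (if n = a then ((q - 2 : ℝ) : ℂ) * (b m * (starRingEnd ℂ) (b n)) else 0)
          else 0) := by
      intro m n
      simp only [w, ite_and]
      push_cast
      split_ifs <;> push_cast <;> ring
    have single : ∀ (c d : F) (G : F → F → ℂ),
        ∑ m, ∑ n, (if m = c then (if n = d then G m n else 0) else 0) = G c d := by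
      intro c d G
      rw [Fintype.sum_eq_single c (fun m hm => by simp [hm])]
      simp
    simp only [e, Finset.sum_add_distrib, single]
    have hc : b a' * (starRingEnd ℂ) (b a) = (starRingEnd ℂ) (b a * (starRingEnd ℂ) (b a')) := by
      simp [mul_comm]
    rw [hc, add_assoc, ← mul_add, Complex.add_conj]
    push_cast
    ring
  have herr : ‖∑ m, ∑ n, (w m n : ℂ) * (b m * (starRingEnd ℂ) (b n))‖ ≤
      5 * q ^ (3 / 4 : ℝ) * (∑ m, ‖b m‖) ^ 2 := by
    rw [sq, Finset.sum_mul_sum, Finset.mul_sum]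
    refine (norm_sum_le _ _).trans (Finset.sum_le_sum fun m _ => ?_)
    rw [Finset.mul_sum]
    refine (norm_sum_le _ _).trans (Finset.sum_le_sum fun n _ => ?_)
    rw [norm_mul, norm_mul, RCLike.norm_conj, Complex.norm_real, Real.norm_eq_abs]
    exact mul_le_mul_of_nonneg_right (hw m n) (by positivity)
  have hmain : |(∑ j, (Φ j : ℝ) * ‖v j‖ ^ 2) - 2 * (q - 2) * (b a * (starRingEnd ℂ) (b a')).re| ≤
      5 * q ^ (3 / 4 : ℝ) * (∑ m, ‖b m‖) ^ 2 := by
    refine le_trans (le_of_eq ?_) herr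
    rw [← Real.norm_eq_abs, ← Complex.norm_real, Complex.ofReal_sub, hexp, hsplit,
      add_sub_cancel_right]
  have hup : |∑ j, (Φ j : ℝ) * (‖v j‖ ^ 2 - 1)| ≤ ∑ j, |‖v j‖ ^ 2 - 1| := by
    refine (Finset.abs_sum_le_sum_abs _ _).trans (Finset.sum_le_sum fun j _ => ?_)
    rw [abs_mul]
    exact mul_le_of_le_one_left (abs_nonneg _) (hΦ j)
  simp only [mul_sub, mul_one, Finset.sum_sub_distrib, hΦsum] at hup
  have habs : |2 * (q - 2) * (b a * (starRingEnd ℂ) (b a')).re| =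
      2 * (q - 2) * |(b a * (starRingEnd ℂ) (b a')).re| := by
    rw [abs_mul, abs_of_nonneg (by linarith)]
  rw [← habs]
  set X := ∑ j, (Φ j : ℝ) * ‖v j‖ ^ 2
  set Y := 2 * (q - 2) * (b a * (starRingEnd ℂ) (b a')).re
  have h1 : |Y| ≤ |X - Y| + |X| := by
    have := abs_sub_abs_le_abs_sub Y X
    rw [abs_sub_comm Y X] at this
    linarith
  have h2 : |X| ≤ |X - -1| + 1 := by
    have := abs_add_le (X - -1) (-1)
    simpa using this
  linarith

end QuadraticCharacterSums

/-! ### Interpolation of the shifted Fekete polynomials at the `p`-th roots of unity -/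

section Interpolation

lemma legendreC_eq_quadraticChar (p : Nat.Primes) [Fact (p : ℕ).Prime] (a : ℤ) :
    legendreC p a = (quadraticChar (ZMod p) (a : ZMod p) : ℂ) := rfl

/-- The quadratic character of `ZMod p` with complex values. -/
noncomputable def quadraticCharC (p : ℕ) [Fact p.Prime] : MulChar (ZMod p) ℂ :=
  (quadraticChar (ZMod p)).ringHomComp (Int.castRingHom ℂ)

lemma quadraticCharC_apply (p : ℕ) [Fact p.Prime] (a : ZMod p) :
    quadraticCharC p a = (quadraticChar (ZMod p) a : ℂ) := rfl

lemma quadraticCharC_isQuadratic (p : ℕ) [Fact p.Prime] : (quadraticCharC p).IsQuadratic :=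
  (quadraticChar_isQuadratic (ZMod p)).comp _

lemma quadraticCharC_ne_one {p : ℕ} [Fact p.Prime] (hp : p ≠ 2) : quadraticCharC p ≠ 1 := by
  have hF : ringChar (ZMod p) ≠ 2 := by rwa [ZMod.ringChar_zmod_n]
  obtain ⟨a, ha⟩ := quadraticChar_exists_neg_one' hF
  intro h
  have h1 := congrArg (fun χ : MulChar (ZMod p) ℂ => χ a) h
  simp only [quadraticCharC_apply, ha, MulChar.one_apply_coe] at h1
  norm_num at h1

/-- The Fourier expansion of the quadratic character. -/
lemma gaussSum_mul_quadraticCharC {p : ℕ} [Fact p.Prime] (hp : p ≠ 2) (n : ZMod p) :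
    gaussSum (quadraticCharC p) ZMod.stdAddChar * quadraticCharC p n =
      ∑ m, quadraticCharC p m * ZMod.stdAddChar (m * n) := by
  rcases eq_or_ne n 0 with rfl | hn
  · simp only [mul_zero, AddChar.map_zero_eq_one, mul_one, MulChar.map_zero]
    exact (MulChar.sum_eq_zero_of_ne_one (quadraticCharC_ne_one hp)).symm
  · have h := gaussSum_mulShift_eq (quadraticCharC p) (ZMod.stdAddChar (N := p)) (Units.mk0 n hn)
    rw [(quadraticCharC_isQuadratic p).inv, Units.val_mk0, mul_comm] at h
    rw [← h, gaussSum]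
    refine Finset.sum_congr rfl fun m _ => ?_
    rw [AddChar.mulShift_apply, mul_comm n m]

lemma norm_sq_gaussSum_quadraticCharC {p : ℕ} [Fact p.Prime] (hp : p ≠ 2) :
    ‖gaussSum (quadraticCharC p) (ZMod.stdAddChar (N := p))‖ ^ 2 = p := by
  have h : gaussSum (quadraticCharC p) (ZMod.stdAddChar (N := p)) ^ 2 =
      quadraticCharC p (-1) * Fintype.card (ZMod p) :=
    gaussSum_sq (quadraticCharC_ne_one hp) (quadraticCharC_isQuadratic p) (ZMod.isPrimitive_stdAddChar p)
  rw [← norm_pow, h, norm_mul, ZMod.card, Complex.norm_natCast,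
    quadraticCharC_apply]
  rcases quadraticChar_dichotomy (F := ZMod p) (a := -1) (by simp) with h | h <;> simp [h]

lemma norm_stdAddChar {p : ℕ} [NeZero p] (m : ZMod p) : ‖ZMod.stdAddChar m‖ = 1 := by
  rw [ZMod.stdAddChar_apply, Circle.norm_coe]

/-- The coefficients that express the values of the shifted Fekete polynomials at the points
`z * e ^ (2 π i j / p)` through the values of the quadratic character: Dirichlet kernels with the
phase that comes from the shift `t`. -/
noncomputable def interpKernel (p : ℕ) [NeZero p] (t : ℤ) (z : ℂ) (m : ZMod p) : ℂ :=
  ZMod.stdAddChar (m * (t : ZMod p)) * (∑ k ∈ Finset.range p, (z * ZMod.stdAddChar m) ^ k) / p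

/-- Up to a phase, the values of the normalized shifted Fekete polynomial along a coset of the `p`-th
roots of unity are the translates of a single linear form in the quadratic character. -/
lemma norm_sq_eval_shiftedFekete (p : Nat.Primes) [Fact (p : ℕ).Prime] (hp : (p : ℕ) ≠ 2) (t : ℤ)
    (z : ℂ) (j : ZMod p) :
    ‖(shiftedFekete p t).eval (z * ZMod.stdAddChar j)‖ ^ 2 / (p : ℕ) =
      ‖∑ m, (quadraticChar (ZMod p) (m - j) : ℂ) * interpKernel p t z m‖ ^ 2 := by
  set χ := quadraticCharC p with hχ
  set ψ := ZMod.stdAddChar (N := p) with hψ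
  set τ := gaussSum χ ψ with hτ
  have hp0 : ((p : ℕ) : ℂ) ≠ 0 := by exact_mod_cast (p.2.ne_zero)
  have hpow : ∀ (m : ZMod p) (k : ℕ), ψ (m * k) = ψ m ^ k := by
    intro m k
    rw [← AddChar.map_nsmul_eq_pow, nsmul_eq_mul, mul_comm]
  have h1 : τ * (shiftedFekete p t).eval (z * ψ j) =
      ψ (-j * t) * ((p : ℕ) * ∑ m, (quadraticChar (ZMod p) (m - j) : ℂ) * interpKernel p t z m) := by
    calc τ * (shiftedFekete p t).eval (z * ψ j)
        = ∑ k ∈ Finset.range (p : ℕ), (τ * χ ((k : ZMod p) + t)) * (z * ψ j) ^ k := by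
          rw [shiftedFekete, Polynomial.eval_finsetSum, Finset.mul_sum]
          refine Finset.sum_congr rfl fun k _ => ?_
          rw [legendreC_eq_quadraticChar, Polynomial.eval_mul, Polynomial.eval_C,
            Polynomial.eval_pow, Polynomial.eval_X, hχ, quadraticCharC_apply]
          push_cast
          ring
      _ = ∑ k ∈ Finset.range (p : ℕ), ∑ m, χ m * ψ (m * t) * (z * ψ (m + j)) ^ k := by
          refine Finset.sum_congr rfl fun k _ => ?_
          rw [hτ, hχ, hψ, gaussSum_mul_quadraticCharC hp, Finset.sum_mul, ← hχ, ← hψ]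
          refine Finset.sum_congr rfl fun m _ => ?_
          rw [mul_add, AddChar.map_add_eq_mul, AddChar.map_add_eq_mul, hpow]
          ring
      _ = ∑ m, χ m * ψ (m * t) * ∑ k ∈ Finset.range (p : ℕ), (z * ψ (m + j)) ^ k := by
          rw [Finset.sum_comm]
          simp only [Finset.mul_sum]
      _ = ∑ m, χ (m - j) * ψ ((m - j) * t) * ∑ k ∈ Finset.range (p : ℕ), (z * ψ m) ^ k := by
          exact Fintype.sum_equiv (Equiv.addRight j) _ _ fun m => by simp
      _ = _ := by
          rw [Finset.mul_sum, Finset.mul_sum]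
          refine Finset.sum_congr rfl fun m _ => ?_
          rw [hχ, quadraticCharC_apply, interpKernel, ← hψ,
            show (m - j) * (t : ZMod p) = -j * t + m * t by ring, AddChar.map_add_eq_mul]
          field_simp
  have h2 := congrArg (fun w : ℂ => ‖w‖ ^ 2) h1
  simp only [norm_mul, mul_pow, hτ, hχ, hψ, norm_sq_gaussSum_quadraticCharC hp, norm_stdAddChar,
    Complex.norm_natCast, one_mul] at h2
  have hpr : ((p : ℕ) : ℝ) ≠ 0 := by exact_mod_cast (p.2.ne_zero)
  field_simp
  have h3 : ((p : ℕ) : ℝ) * (‖(shiftedFekete p t).eval (z * ZMod.stdAddChar j)‖ ^ 2) =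
    (p : ℕ) * ((p : ℕ) * ‖∑ m, (quadraticChar (ZMod p) (m - j) : ℂ) * interpKernel p t z m‖ ^ 2) := by
    rw [h2]; ring
  exact mul_left_cancel₀ hpr h3

end Interpolation

/-! ### Estimates for the interpolation kernel -/

section Kernel

/-- The point `e ^ (2 π i u)` of the unit circle. -/
noncomputable def unitExp (u : ℝ) : ℂ := Complex.exp (2 * Real.pi * u * Complex.I)

lemma unitExp_add (u v : ℝ) : unitExp (u + v) = unitExp u * unitExp v := by
  rw [unitExp, unitExp, unitExp, ← Complex.exp_add]; push_cast; ring_nf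

lemma unitExp_pow (u : ℝ) (n : ℕ) : unitExp u ^ n = unitExp (n * u) := by
  rw [unitExp, unitExp, ← Complex.exp_nat_mul]; push_cast; ring_nf

lemma norm_unitExp (u : ℝ) : ‖unitExp u‖ = 1 := by
  rw [unitExp, show (2 * Real.pi * u * Complex.I : ℂ) = ((2 * Real.pi * u : ℝ) : ℂ) * Complex.I by
    push_cast; ring, Complex.norm_exp_ofReal_mul_I]

lemma unitExp_re (u : ℝ) : (unitExp u).re = Real.cos (2 * Real.pi * u) := by
  rw [unitExp, show (2 * Real.pi * u * Complex.I : ℂ) = ((2 * Real.pi * u : ℝ) : ℂ) * Complex.I by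
    push_cast; ring, Complex.exp_ofReal_mul_I_re]

lemma conj_unitExp (u : ℝ) : (starRingEnd ℂ) (unitExp u) = unitExp (-u) := by
  rw [unitExp, unitExp, ← Complex.exp_conj]
  simp [map_ofNat]

lemma unitExp_sub_one (u : ℝ) :
    unitExp u - 1 = unitExp (u / 2) * (2 * Complex.I * Real.sin (Real.pi * u)) := by
  have h1 : unitExp u = unitExp (u / 2) * unitExp (u / 2) := by rw [← unitExp_add]; ring_nf
  have h2 : (1 : ℂ) = unitExp (u / 2) * unitExp (-(u / 2)) := by
    rw [← unitExp_add]; simp [unitExp]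
  have h3 : unitExp (u / 2) - unitExp (-(u / 2)) = 2 * Complex.I * Real.sin (Real.pi * u) := by
    rw [Complex.ofReal_sin, Complex.sin, unitExp, unitExp]
    push_cast
    rw [show (2 * Real.pi * (u / 2) * Complex.I : ℂ) = Real.pi * u * Complex.I by ring,
      show (2 * Real.pi * (-(u / 2)) * Complex.I : ℂ) = -(Real.pi * u) * Complex.I by ring]
    linear_combination (-(Complex.exp (-(Real.pi * u) * Complex.I) -
      Complex.exp (Real.pi * u * Complex.I))) * Complex.I_sq
  calc unitExp u - 1 = unitExp (u / 2) * (unitExp (u / 2) - unitExp (-(u / 2))) := by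
        rw [mul_sub, ← h1, ← h2]
    _ = _ := by rw [h3]

lemma stdAddChar_intCast_eq_unitExp {p : ℕ} [NeZero p] (a : ℤ) :
    ZMod.stdAddChar (a : ZMod p) = unitExp (a / p) := by
  rw [ZMod.stdAddChar_coe, unitExp]; push_cast; ring_nf

/-- The kernel at `e ^ (2 π i θ / p)`, as a quotient of sines with an explicit phase. -/
lemma interpKernel_unitExp {p : ℕ} [NeZero p] (t a : ℤ) (θ : ℝ)
    (h : Real.sin (Real.pi * ((θ + a) / p)) ≠ 0) :
    interpKernel p t (unitExp (θ / p)) (a : ZMod p) =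
      unitExp (a * t / p + θ / 2 - (θ + a) / (2 * p)) *
        ((Real.sin (Real.pi * θ) / (p * Real.sin (Real.pi * ((θ + a) / p))) : ℝ) : ℂ) := by
  have hp : (p : ℝ) ≠ 0 := by exact_mod_cast NeZero.ne p
  have hpc : (p : ℂ) ≠ 0 := by exact_mod_cast NeZero.ne p
  have hz : unitExp (θ / p) * ZMod.stdAddChar (a : ZMod p) = unitExp ((θ + a) / p) := by
    rw [stdAddChar_intCast_eq_unitExp, ← unitExp_add]; ring_nf
  have hu : ∀ u, unitExp u ≠ 0 := fun u => by simp [unitExp]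
  have hs : ((Real.sin (Real.pi * ((θ + a) / p)) : ℝ) : ℂ) ≠ 0 := by exact_mod_cast h
  have hne : unitExp ((θ + a) / p) - 1 ≠ 0 := by
    rw [unitExp_sub_one]
    exact mul_ne_zero (hu _) (mul_ne_zero (mul_ne_zero two_ne_zero Complex.I_ne_zero) hs)
  have hpw : unitExp ((θ + a) / p) ^ p = unitExp θ := by
    rw [unitExp_pow, mul_div_cancel₀ _ hp, unitExp_add]
    have : unitExp (a : ℝ) = 1 := by
      rw [unitExp, Complex.exp_eq_one_iff]
      exact ⟨a, by push_cast; ring⟩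
    rw [this, mul_one]
  have hsplit : unitExp (a * t / p + θ / 2 - (θ + a) / (2 * p)) * unitExp ((θ + a) / p / 2) =
      unitExp (a * t / p) * unitExp (θ / 2) := by
    rw [← unitExp_add, ← unitExp_add]; congr 1; field_simp; ring
  rw [interpKernel, hz, geom_sum_eq (sub_ne_zero.1 hne), hpw,
    show (a : ZMod p) * (t : ZMod p) = ((a * t : ℤ) : ZMod p) by push_cast; ring,
    stdAddChar_intCast_eq_unitExp, mul_div_assoc, div_div, mul_div_assoc', div_eq_iff
    (mul_ne_zero hne hpc), unitExp_sub_one, unitExp_sub_one]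
  rw [Complex.ofReal_div, Complex.ofReal_mul, Complex.ofReal_natCast]
  generalize ((Real.sin (Real.pi * ((θ + a) / p)) : ℝ) : ℂ) = S at hs ⊢
  generalize ((Real.sin (Real.pi * θ) : ℝ) : ℂ) = S'
  generalize unitExp (a * t / p + θ / 2 - (θ + a) / (2 * p)) = E at hsplit ⊢
  generalize unitExp ((θ + a) / p / 2) = E' at hsplit ⊢
  have e : E * (S' / (p * S)) * (E' * (2 * Complex.I * S) * p) = (E * E') * (2 * Complex.I * S') := by
    field_simp
  rw [e, hsplit, Int.cast_mul]
  ring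

end Kernel

section Kernel

lemma sum_zmod_eq_sum_range {M : Type*} [AddCommMonoid M] (p : ℕ) [NeZero p] (g : ZMod p → M) :
    ∑ m, g m = ∑ k ∈ Finset.range p, g (k : ZMod p) := by
  refine (Finset.sum_nbij' (fun k : ℕ => (k : ZMod p)) ZMod.val ?_ ?_ ?_ ?_ ?_).symm
  · simp
  · intro m _; exact Finset.mem_range.2 m.val_lt
  · intro k hk; exact ZMod.val_cast_of_lt (Finset.mem_range.1 hk)
  · intro m _; exact ZMod.natCast_zmod_val m
  · simp

/-- On the circle, the distance of `x` to the integers is controlled by `sin (π x)`. -/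
lemma two_mul_min_le_sin_pi {x : ℝ} (h0 : 0 ≤ x) (h1 : x ≤ 1) :
    2 * min x (1 - x) ≤ Real.sin (Real.pi * x) := by
  have key : ∀ y : ℝ, 0 ≤ y → y ≤ 1 / 2 → 2 * y ≤ Real.sin (Real.pi * y) := by
    intro y hy hy'
    have := Real.mul_le_sin (x := Real.pi * y) (by positivity) (by nlinarith [Real.pi_pos])
    calc 2 * y = 2 / Real.pi * (Real.pi * y) := by field_simp
      _ ≤ _ := this
  rcases le_total x (1 / 2) with h | h
  · exact (mul_le_mul_of_nonneg_left (min_le_left _ _) (by norm_num)).trans (key x h0 h)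
  · rw [← Real.sin_pi_sub, show Real.pi - Real.pi * x = Real.pi * (1 - x) by ring]
    exact (mul_le_mul_of_nonneg_left (min_le_right _ _) (by norm_num)).trans
      (key (1 - x) (by linarith) (by linarith))

variable {p : ℕ} [NeZero p] {θ : ℝ}

lemma norm_interpKernel_le (t : ℤ) (hθ : 1 / 4 ≤ θ) (hθ' : θ ≤ 3 / 4) {m : ℕ} (hm : m < p) :
    ‖interpKernel p t (unitExp (θ / p)) (m : ZMod p)‖ ≤ 2 / (m + 1) + 2 / (p - m) := by
  have hm' : (m : ℝ) + 1 ≤ p := by exact_mod_cast hm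
  have hm0 : (0 : ℝ) ≤ m := Nat.cast_nonneg m
  have hp : (0 : ℝ) < p := by linarith
  set v : ℝ := (θ + m) / p with hv
  have hpv : p * v = θ + m := by rw [hv]; field_simp
  have hv0 : 0 < v := by rw [hv]; apply div_pos <;> linarith
  have hv1 : v < 1 := by rw [hv, div_lt_one hp]; linarith
  have hmin : 0 < min v (1 - v) := lt_min hv0 (by linarith)
  have hsin := two_mul_min_le_sin_pi hv0.le hv1.le
  have hspos : 0 < Real.sin (Real.pi * v) := by linarith
  have h := interpKernel_unitExp (p := p) t (m : ℤ) θ (by rw [Int.cast_natCast]; exact hspos.ne')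
  rw [Int.cast_natCast, Int.cast_natCast, ← hv] at h
  rw [h, norm_mul, norm_unitExp, one_mul, Complex.norm_real, Real.norm_eq_abs, abs_div,
    abs_of_pos (mul_pos hp hspos)]
  have h1 : |Real.sin (Real.pi * θ)| / (p * Real.sin (Real.pi * v)) ≤
      1 / (p * (2 * min v (1 - v))) := by
    gcongr
    exact Real.abs_sin_le_one _
  refine h1.trans ?_
  have h2 : (m + 1 : ℝ) / 4 ≤ p * v := by rw [hpv]; linarith
  have h3 : (p - m : ℝ) / 4 ≤ p * (1 - v) := by rw [mul_sub, hpv]; linarith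
  have hpm : (0 : ℝ) < p - m := by linarith
  rcases le_total v (1 - v) with hle | hle
  · rw [min_eq_left hle]
    have : 1 / (p * (2 * v)) ≤ 2 / (m + 1 : ℝ) := by
      rw [div_le_div_iff₀ (by positivity) (by positivity)]; nlinarith
    have : 0 ≤ 2 / (p - m : ℝ) := by positivity
    linarith
  · rw [min_eq_right hle]
    have h0 : 0 < 1 - v := by linarith
    have : 1 / (p * (2 * (1 - v))) ≤ 2 / (p - m : ℝ) := by
      rw [div_le_div_iff₀ (by positivity) (by positivity)]; nlinarith
    have : 0 ≤ 2 / (m + 1 : ℝ) := by positivity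
    linarith

lemma sum_norm_interpKernel_le (t : ℤ) (hθ : 1 / 4 ≤ θ) (hθ' : θ ≤ 3 / 4) :
    ∑ m : ZMod p, ‖interpKernel p t (unitExp (θ / p)) m‖ ≤ 4 * (1 + Real.log p) := by
  rw [sum_zmod_eq_sum_range]
  have hH : ∑ m ∈ Finset.range p, 2 / ((m : ℝ) + 1) ≤ 2 * (1 + Real.log p) := by
    have h := harmonic_le_one_add_log p
    rw [harmonic] at h
    push_cast at h
    simp only [div_eq_mul_inv, ← Finset.mul_sum]
    linarith
  have hrefl : ∑ m ∈ Finset.range p, 2 / ((p : ℝ) - m) = ∑ m ∈ Finset.range p, 2 / ((m : ℝ) + 1) := by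
    rw [← Finset.sum_range_reflect]
    refine Finset.sum_congr rfl fun m hm => ?_
    have hm' := Finset.mem_range.1 hm
    congr 1
    rw [Nat.sub_sub, Nat.cast_sub (by omega)]
    push_cast; ring
  calc _ ≤ ∑ m ∈ Finset.range p, (2 / ((m : ℝ) + 1) + 2 / ((p : ℝ) - m)) :=
        Finset.sum_le_sum fun m hm => norm_interpKernel_le t hθ hθ' (Finset.mem_range.1 hm)
    _ ≤ _ := by rw [Finset.sum_add_distrib, hrefl]; linarith

/-- The correlation of two kernel coefficients close to the evaluation point. The cosine is the
only place where the shift `t` enters. -/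
lemma abs_re_interpKernel_mul_conj (hp : 3 ≤ p) (t : ℤ) (hθ : 1 / 4 ≤ θ) (hθ' : θ ≤ 3 / 4) {a : ℤ}
    (ha : 0 ≤ a) (ha' : a ≤ 1) :
    |Real.cos (2 * Real.pi * ((a + 1) * (t - 1 / 2) / p))| / 80 ≤
      |(interpKernel p t (unitExp (θ / p)) (a : ZMod p) *
        (starRingEnd ℂ) (interpKernel p t (unitExp (θ / p)) ((-1 : ℤ) : ZMod p))).re| := by
  have hp' : (3 : ℝ) ≤ p := by exact_mod_cast hp
  have hp0 : (0 : ℝ) < p := by linarith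
  have haR : (0 : ℝ) ≤ a := by exact_mod_cast ha
  have haR' : (a : ℝ) ≤ 1 := by exact_mod_cast ha'
  have hs : ∀ x : ℝ, x ≠ 0 → |x| < p → Real.sin (Real.pi * (x / p)) ≠ 0 := by
    intro x hx hxp h
    rw [abs_lt] at hxp
    rw [Real.sin_eq_zero_iff_of_lt_of_lt] at h
    · exact (mul_ne_zero Real.pi_ne_zero (div_ne_zero hx hp0.ne')) h
    · have : -1 < x / p := by rw [lt_div_iff₀ hp0]; linarith
      nlinarith [Real.pi_pos]
    · have : x / p < 1 := by rw [div_lt_iff₀ hp0]; linarith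
      nlinarith [Real.pi_pos]
  have hsa := hs (θ + a) (by linarith) (by rw [abs_lt]; constructor <;> linarith)
  have hsb := hs (θ + (-1 : ℤ)) (by push_cast; linarith)
    (by rw [abs_lt]; push_cast; constructor <;> linarith)
  have hle : ∀ x : ℝ, Real.sin (Real.pi * (x / p)) ≠ 0 →
      1 / (2 * Real.pi * |x|) ≤
      |Real.sin (Real.pi * θ) / (p * Real.sin (Real.pi * (x / p)))| := by
    intro x hx
    have h1 : (1 : ℝ) / 2 ≤ Real.sin (Real.pi * θ) := by
      refine le_trans ?_ (two_mul_min_le_sin_pi (by linarith) (by linarith))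
      have : (1 : ℝ) / 4 ≤ min θ (1 - θ) := le_min hθ (by linarith)
      linarith
    have h2 : p * |Real.sin (Real.pi * (x / p))| ≤ Real.pi * |x| := by
      have := Real.abs_sin_le_abs (x := Real.pi * (x / p))
      rw [abs_mul, abs_div, abs_of_pos Real.pi_pos, abs_of_pos hp0] at this
      calc p * |Real.sin (Real.pi * (x / p))| ≤ p * (Real.pi * (|x| / p)) := by gcongr
        _ = Real.pi * |x| := by field_simp
    rw [abs_div, abs_mul, abs_of_pos hp0, abs_of_pos (by linarith : 0 < Real.sin (Real.pi * θ))]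
    calc 1 / (2 * Real.pi * |x|) = (1 / 2) / (Real.pi * |x|) := by field_simp
      _ ≤ Real.sin (Real.pi * θ) / (p * |Real.sin (Real.pi * (x / p))|) := by
        have : 0 < |Real.sin (Real.pi * (x / p))| := abs_pos.2 hx
        gcongr
  have hphase : (a * t / p + θ / 2 - (θ + a) / (2 * p) : ℝ) +
      -(((-1 : ℤ) : ℝ) * t / p + θ / 2 - (θ + ((-1 : ℤ) : ℝ)) / (2 * p)) =
      (a + 1) * (t - 1 / 2) / p := by
    push_cast; field_simp; ring
  rw [interpKernel_unitExp t a θ hsa, interpKernel_unitExp t (-1) θ hsb, map_mul, conj_unitExp,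
    Complex.conj_ofReal, mul_mul_mul_comm, ← unitExp_add, hphase, ← Complex.ofReal_mul,
    Complex.re_mul_ofReal, unitExp_re, abs_mul, abs_mul, div_eq_mul_one_div]
  gcongr
  have h1 := hle _ hsa
  have h2 := hle _ hsb
  refine le_trans ?_ (mul_le_mul h1 h2 (by positivity) (abs_nonneg _))
  have e1 : |θ + (a : ℝ)| ≤ 2 := by rw [abs_le]; constructor <;> linarith
  have e2 : |θ + ((-1 : ℤ) : ℝ)| ≤ 1 := by
    push_cast; rw [abs_le]; constructor <;> linarith
  have p1 : 0 < |θ + (a : ℝ)| := abs_pos.2 (by linarith)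
  have p2 : 0 < |θ + ((-1 : ℤ) : ℝ)| := abs_pos.2 (by push_cast; linarith)
  rw [one_div_mul_one_div]
  apply one_div_le_one_div_of_le (by positivity)
  have hpi : Real.pi ^ 2 ≤ 10 := by nlinarith [Real.pi_lt_d2, Real.pi_pos]
  have e3 : |θ + (a : ℝ)| * |θ + ((-1 : ℤ) : ℝ)| ≤ 2 * 1 := mul_le_mul e1 e2 p2.le (by norm_num)
  calc 2 * Real.pi * |θ + (a : ℝ)| * (2 * Real.pi * |θ + ((-1 : ℤ) : ℝ)|)
      = 4 * Real.pi ^ 2 * (|θ + (a : ℝ)| * |θ + ((-1 : ℤ) : ℝ)|) := by ring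
    _ ≤ 4 * 10 * (2 * 1) := by gcongr
    _ = 80 := by norm_num

end Kernel

/-! ### The lower bound on average over an arc -/

section DiscreteBound

/-- For one of the pairs `(0, -1)`, `(1, -1)` the kernel correlation is bounded below, because
`cos φ` and `cos (2 φ)` are never both small. -/
lemma exists_interpKernel_correlation {p : ℕ} [NeZero p] (hp : 3 ≤ p) (t : ℤ) {θ : ℝ}
    (hθ : 1 / 4 ≤ θ) (hθ' : θ ≤ 3 / 4) :
    ∃ a b : ZMod p, a ≠ b ∧ 1 / 160 ≤ |(interpKernel p t (unitExp (θ / p)) a *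
      (starRingEnd ℂ) (interpKernel p t (unitExp (θ / p)) b)).re| := by
  have hne : ∀ a : ℕ, a + 1 < p → 0 < a + 1 → (((a : ℕ) : ℤ) : ZMod p) ≠ ((-1 : ℤ) : ZMod p) := by
    intro a ha ha0 h
    have h1 : (((a + 1 : ℕ)) : ZMod p) = 0 := by
      push_cast at h ⊢; rw [h]; ring
    rw [ZMod.natCast_eq_zero_iff] at h1
    exact absurd (Nat.le_of_dvd ha0 h1) (by omega)
  set φ : ℝ := 2 * Real.pi * ((t - 1 / 2) / p) with hφ
  by_cases hc : 1 / 2 ≤ |Real.cos φ|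
  -- the angles for the two pairs are `φ` and `2 * φ`
  · refine ⟨((0 : ℕ) : ℤ), (-1 : ℤ), hne 0 (by omega) (by omega), ?_⟩
    have h := abs_re_interpKernel_mul_conj hp t hθ hθ' (a := ((0 : ℕ) : ℤ)) (by norm_num)
      (by norm_num)
    refine le_trans ?_ h
    have e : 2 * Real.pi * (((((0 : ℕ) : ℤ) : ℝ) + 1) * (t - 1 / 2) / p) = φ := by
      rw [hφ]; push_cast; ring
    rw [e]; linarith
  · refine ⟨((1 : ℕ) : ℤ), (-1 : ℤ), hne 1 (by omega) (by omega), ?_⟩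
    have h := abs_re_interpKernel_mul_conj hp t hθ hθ' (a := ((1 : ℕ) : ℤ)) (by norm_num)
      (by norm_num)
    refine le_trans ?_ h
    have e : 2 * Real.pi * (((((1 : ℕ) : ℤ) : ℝ) + 1) * (t - 1 / 2) / p) = 2 * φ := by
      rw [hφ]; push_cast; ring
    have h2 : 1 / 2 ≤ |Real.cos (2 * φ)| := by
      rw [Real.cos_two_mul, ← sq_abs, abs_sub_comm]
      refine le_trans ?_ (le_abs_self _)
      nlinarith [abs_nonneg (Real.cos φ)]
    rw [e]; linarith

/-- The main term `2 (p - 2) / 160` of the tested average dominates the error terms. -/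
lemma eventually_rpow_log_le :
    ∀ᶠ x : ℝ in Filter.atTop,
      x / 160 ≤ 2 * (x - 2) * (1 / 160) - 5 * x ^ (3 / 4 : ℝ) * (4 * (1 + Real.log x)) ^ 2 - 1 := by
  have h1 := (tendsto_rpow_atTop (show (0 : ℝ) < 1 / 8 by norm_num)).eventually_ge_atTop
    (23122 * 160)
  filter_upwards [h1, Filter.eventually_ge_atTop 1] with x hx hx1
  have hx0 : 0 < x := by linarith
  -- `(log x)²` costs a factor `x ^ (1 / 8)`, which leaves an error of order `x ^ (7 / 8)`
  have hlog : 1 + Real.log x ≤ 17 * x ^ (1 / 16 : ℝ) := by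
    have h2 := Real.log_le_rpow_div hx0.le (show (0 : ℝ) < 1 / 16 by norm_num)
    have h3 : 1 ≤ x ^ (1 / 16 : ℝ) := Real.one_le_rpow hx1 (by norm_num)
    linarith
  have hlog0 : 0 ≤ 1 + Real.log x := by linarith [Real.log_nonneg hx1]
  have h4 : 1 ≤ x ^ (7 / 8 : ℝ) := Real.one_le_rpow hx1 (by norm_num)
  have h5 : x ^ (1 / 8 : ℝ) * x ^ (7 / 8 : ℝ) = x := by
    rw [← Real.rpow_add hx0]; norm_num
  have h6 : 5 * x ^ (3 / 4 : ℝ) * (4 * (1 + Real.log x)) ^ 2 ≤ 23120 * x ^ (7 / 8 : ℝ) := by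
    calc 5 * x ^ (3 / 4 : ℝ) * (4 * (1 + Real.log x)) ^ 2
        ≤ 5 * x ^ (3 / 4 : ℝ) * (4 * (17 * x ^ (1 / 16 : ℝ))) ^ 2 := by gcongr
      _ = 23120 * (x ^ (3 / 4 : ℝ) * (x ^ (1 / 16 : ℝ)) ^ 2) := by ring
      _ = 23120 * x ^ (7 / 8 : ℝ) := by
          rw [← Real.rpow_natCast, ← Real.rpow_mul hx0.le, ← Real.rpow_add hx0]; norm_num
  have h7 : 23122 * 160 * x ^ (7 / 8 : ℝ) ≤ x := by
    calc _ ≤ x ^ (1 / 8 : ℝ) * x ^ (7 / 8 : ℝ) := by gcongr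
      _ = x := h5
  linarith

/-- Along the translates by `p`-th roots of unity of any point of the middle half of an arc, the
squared modulus of the normalized shifted Fekete polynomial is not close to `1` on average. -/
lemma exists_le_sum_abs_shiftedFekete :
    ∃ N : ℕ, ∀ p : Nat.Primes, N ≤ (p : ℕ) → ∀ (t : ℤ) (θ : ℝ), 1 / 4 ≤ θ → θ ≤ 3 / 4 →
      ((p : ℕ) : ℝ) / 160 ≤ ∑ j ∈ Finset.range (p : ℕ),
        |‖(shiftedFekete p t).eval (unitExp ((θ + j) / (p : ℕ)))‖ ^ 2 / (p : ℕ) - 1| := by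
  obtain ⟨X, hX⟩ := Filter.eventually_atTop.1 eventually_rpow_log_le
  refine ⟨max 3 ⌈X⌉₊, fun p hp t θ hθ hθ' => ?_⟩
  have : Fact (p : ℕ).Prime := ⟨p.2⟩
  have hp3 : 3 ≤ (p : ℕ) := (le_max_left _ _).trans hp
  have hpX : X ≤ ((p : ℕ) : ℝ) :=
    (Nat.le_ceil X).trans (by exact_mod_cast (le_max_right _ _).trans hp)
  have hp2 : (p : ℕ) ≠ 2 := by omega
  have hF : ringChar (ZMod p) ≠ 2 := by rwa [ZMod.ringChar_zmod_n]
  obtain ⟨a, b, hab, hcorr⟩ := exists_interpKernel_correlation hp3 t hθ hθ'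
  have h1 := le_sum_abs_sq_norm_sub_one hF (interpKernel p t (unitExp (θ / (p : ℕ)))) hab
  rw [ZMod.card] at h1
  have h2 := sum_norm_interpKernel_le (p := (p : ℕ)) t hθ hθ'
  have h3 : ∑ j : ZMod p, |‖∑ m, (quadraticChar (ZMod p) (m - j) : ℂ) *
      interpKernel p t (unitExp (θ / (p : ℕ))) m‖ ^ 2 - 1| =
      ∑ j ∈ Finset.range (p : ℕ),
        |‖(shiftedFekete p t).eval (unitExp ((θ + j) / (p : ℕ)))‖ ^ 2 / (p : ℕ) - 1| := by
    rw [sum_zmod_eq_sum_range]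
    refine Finset.sum_congr rfl fun j _ => ?_
    have e : ZMod.stdAddChar (j : ZMod p) = unitExp (j / (p : ℕ)) := by
      simpa using stdAddChar_intCast_eq_unitExp (p := (p : ℕ)) (j : ℤ)
    rw [← norm_sq_eval_shiftedFekete p hp2, e, ← unitExp_add, ← add_div]
  rw [← h3]
  refine (hX _ hpX).trans (le_trans ?_ h1)
  have hp3' : (3 : ℝ) ≤ ((p : ℕ) : ℝ) := by exact_mod_cast hp3
  have h0 : (0 : ℝ) ≤ 2 * (((p : ℕ) : ℝ) - 2) := by linarith
  gcongr

end DiscreteBound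

/-! ### Moments on the circle and flatness -/

section CircleMoments

/-- The modulus of a polynomial on the unit circle, parametrized by `t ↦ e ^ (2 π i t)`. -/
noncomputable def normOnCircle (P : Polynomial ℂ) (t : AddCircle (1 : ℝ)) : ℝ :=
  ‖P.eval (AddCircle.toCircle t : ℂ)‖

lemma normOnCircle_nonneg (P : Polynomial ℂ) (t : AddCircle (1 : ℝ)) : 0 ≤ normOnCircle P t :=
  norm_nonneg _

lemma continuous_normOnCircle (P : Polynomial ℂ) : Continuous (normOnCircle P) := by
  unfold normOnCircle
  exact (P.continuous.comp (continuous_subtype_val.comp AddCircle.continuous_toCircle)).norm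

lemma integrable_of_continuous_addCircle {f : AddCircle (1 : ℝ) → ℝ} (hf : Continuous f) :
    MeasureTheory.Integrable f AddCircle.haarAddCircle := by
  simpa using hf.continuousOn.integrableOn_compact (μ := AddCircle.haarAddCircle) isCompact_univ

lemma toCircle_coe_eq_unitExp (x : ℝ) :
    ((AddCircle.toCircle (x : AddCircle (1 : ℝ)) : Circle) : ℂ) = unitExp x := by
  rw [AddCircle.toCircle_apply_mk, Circle.coe_exp, unitExp]
  push_cast
  ring_nf

lemma integral_haarAddCircle_eq_intervalIntegral (g : ℂ → ℝ) :
    ∫ t : AddCircle (1 : ℝ), g (AddCircle.toCircle t) ∂AddCircle.haarAddCircle =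
      ∫ x in (0 : ℝ)..1, g (unitExp x) := by
  have h := AddCircle.intervalIntegral_preimage (1 : ℝ) 0
    (fun t : AddCircle (1 : ℝ) => g (AddCircle.toCircle t))
  simp only [toCircle_coe_eq_unitExp, zero_add] at h
  rw [AddCircle.integral_haarAddCircle, h]
  simp

lemma integral_haarAddCircle_eq_circleAverage (g : ℂ → ℝ) :
    ∫ t : AddCircle (1 : ℝ), g (AddCircle.toCircle t) ∂AddCircle.haarAddCircle =
      Real.circleAverage g 0 1 := by
  rw [integral_haarAddCircle_eq_intervalIntegral, Real.circleAverage]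
  have h := intervalIntegral.integral_comp_mul_left (a := 0) (b := 1)
    (fun x => g (circleMap 0 1 x)) Real.two_pi_pos.ne'
  rw [mul_zero, mul_one] at h
  rw [← h]
  refine intervalIntegral.integral_congr fun x _ => ?_
  simp [unitExp, circleMap]

lemma integral_normOnCircle_sq (P : Polynomial ℂ) :
    ∫ t, normOnCircle P t ^ 2 ∂AddCircle.haarAddCircle = ∑ i ∈ P.support, ‖P.coeff i‖ ^ 2 := by
  rw [P.sum_sq_norm_coeff_eq_circleAverage, ← integral_haarAddCircle_eq_circleAverage]
  rfl

/-- Jensen's inequality: the Mahler measure is at most the `L¹` norm. -/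
lemma mahlerMeasure_le_integral_normOnCircle (P : Polynomial ℂ) :
    P.mahlerMeasure ≤ ∫ t, normOnCircle P t ∂AddCircle.haarAddCircle := by
  have hrhs : ∫ t, normOnCircle P t ∂AddCircle.haarAddCircle =
      Real.circleAverage (fun z => ‖P.eval z‖) 0 1 :=
    integral_haarAddCircle_eq_circleAverage fun z => ‖P.eval z‖
  by_cases hP : P = 0
  · rw [hP, Polynomial.mahlerMeasure_zero]
    exact MeasureTheory.integral_nonneg (normOnCircle_nonneg _)
  rw [hrhs]
  have hfin : MeasureTheory.IsFiniteMeasure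
      (MeasureTheory.volume.restrict (Set.uIoc 0 (2 * Real.pi))) := by
    rw [Set.uIoc_of_le Real.two_pi_pos.le]; infer_instance
  have hnz : NeZero (MeasureTheory.volume (Set.uIoc 0 (2 * Real.pi))) := ⟨by simp⟩
  have hpos : ∀ᵐ (θ : ℝ) ∂MeasureTheory.volume.restrict (Set.uIoc 0 (2 * Real.pi)),
      Real.exp (Real.log ‖P.eval (circleMap 0 1 θ)‖) = ‖P.eval (circleMap 0 1 θ)‖ := by
    have h0 : ∀ᵐ (θ : ℝ) ∂MeasureTheory.volume.restrict (Set.uIoc 0 (2 * Real.pi)),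
        0 < ‖P.eval (circleMap 0 1 θ)‖ := by
      rw [MeasureTheory.ae_restrict_iff' measurableSet_uIoc]
      have hf : {θ : ℝ | θ ∈ Set.uIoc 0 (2 * Real.pi) ∧ P.eval (circleMap 0 1 θ) = 0}.Finite := by
        refine Set.Finite.of_finite_image (f := circleMap 0 1)
          (P.roots.finite_toSet.subset ?_) ?_
        · rintro z ⟨θ, ⟨_, he⟩, rfl⟩
          exact (Polynomial.mem_roots hP).mpr he
        · refine Set.InjOn.mono (fun θ hθ => hθ.1) ?_
          exact injOn_circleMap_of_abs_sub_le one_ne_zero (by simp [abs_of_pos Real.pi_pos])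
      refine MeasureTheory.measure_mono_null ?_ (hf.measure_zero MeasureTheory.volume)
      intro θ hθ
      simpa using hθ
    filter_upwards [h0] with θ hθ using Real.exp_log hθ
  have hcont : Continuous (fun x : ℝ => ‖P.eval (circleMap 0 1 x)‖) := by fun_prop
  rw [Polynomial.mahlerMeasure, if_pos hP, Polynomial.logMahlerMeasure_def,
    Real.circleAverage_eq_intervalAverage,
    Real.circleAverage_eq_intervalAverage, ← MeasureTheory.average_congr hpos]
  refine convexOn_exp.map_average_le Real.continuous_exp.continuousOn isClosed_univ (by simp) ?_ ?_
  · rw [Set.uIoc_of_le Real.two_pi_pos.le]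
    exact ((analyticOnNhd_id.aeval_polynomial P).meromorphicOn.circleIntegrable_log_norm).1
  · exact (MeasureTheory.integrable_congr hpos).mpr hcont.integrableOn_uIoc

lemma integral_normOnCircle_le_one {P : Polynomial ℂ}
    (h : ∫ t, normOnCircle P t ^ 2 ∂AddCircle.haarAddCircle ≤ 1) :
    ∫ t, normOnCircle P t ∂AddCircle.haarAddCircle ≤ 1 := by
  have hi : MeasureTheory.Integrable (fun t => normOnCircle P t ^ 2) AddCircle.haarAddCircle :=
    integrable_of_continuous_addCircle ((continuous_normOnCircle P).pow 2)
  have h1 : ∫ t, normOnCircle P t ∂AddCircle.haarAddCircle ≤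
      ∫ t, (normOnCircle P t ^ 2 + 1) / 2 ∂AddCircle.haarAddCircle := by
    refine MeasureTheory.integral_mono
      (integrable_of_continuous_addCircle (continuous_normOnCircle P))
      (integrable_of_continuous_addCircle
        ((((continuous_normOnCircle P).pow 2).add continuous_const).div_const 2)) fun t => ?_
    simp only
    nlinarith [sq_nonneg (normOnCircle P t - 1)]
  rw [MeasureTheory.integral_div, MeasureTheory.integral_add hi (MeasureTheory.integrable_const _)]
    at h1
  simp at h1
  linarith

/-- Convergence in measure controls the `L¹` norm from below. -/
lemma one_sub_le_integral_normOnCircle (P : Polynomial ℂ) {ε : ℝ} (hε : 0 ≤ ε) :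
    1 - ε - AddCircle.haarAddCircle.real {t | ε ≤ ‖normOnCircle P t - 1‖} ≤
      ∫ t, normOnCircle P t ∂AddCircle.haarAddCircle := by
  set S : Set (AddCircle (1 : ℝ)) := {t | ε ≤ ‖normOnCircle P t - 1‖} with hS
  have hc := continuous_normOnCircle P
  have hSm : MeasurableSet S :=
    (isClosed_le continuous_const (hc.sub continuous_const).norm).measurableSet
  have hind : MeasureTheory.Integrable (S.indicator fun _ => (1 : ℝ)) AddCircle.haarAddCircle :=
    (MeasureTheory.integrable_const 1).indicator hSm
  have h : ∫ t, ((1 - ε) - S.indicator (fun _ => (1 : ℝ)) t) ∂AddCircle.haarAddCircle =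
      1 - ε - AddCircle.haarAddCircle.real S := by
    rw [MeasureTheory.integral_sub (MeasureTheory.integrable_const _) hind,
      MeasureTheory.integral_indicator hSm]
    simp
  rw [← h]
  refine MeasureTheory.integral_mono ((MeasureTheory.integrable_const _).sub hind)
    (integrable_of_continuous_addCircle hc) fun t => ?_
  have h0 := normOnCircle_nonneg P t
  by_cases ht : t ∈ S
  · simp only [Set.indicator_of_mem ht]
    linarith
  · have hlt : ‖normOnCircle P t - 1‖ < ε := not_le.1 ht
    rw [Real.norm_eq_abs, abs_lt] at hlt
    simp only [Set.indicator_of_notMem ht]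
    linarith [hlt.1]

/-- For polynomials of `L²` norm at most `1`, flatness in any of the senses `α ∈ [0, ∞]` forces the
`L¹` norms to converge to `1`. -/
lemma IsFlat.tendsto_integral_normOnCircle {ι : Type*} {l : Filter ι} {α : ℝ≥0∞}
    {P : ι → Polynomial ℂ} (h : IsFlat l α P)
    (hP : ∀ i, ∫ t, normOnCircle (P i) t ^ 2 ∂AddCircle.haarAddCircle ≤ 1) :
    Filter.Tendsto (fun i => ∫ t, normOnCircle (P i) t ∂AddCircle.haarAddCircle) l (nhds 1) := by
  have hup : ∀ i, ∫ t, normOnCircle (P i) t ∂AddCircle.haarAddCircle ≤ 1 := fun i =>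
    integral_normOnCircle_le_one (hP i)
  unfold IsFlat at h
  split_ifs at h with hα
  · exact tendsto_of_tendsto_of_tendsto_of_le_of_le h tendsto_const_nhds
      (fun i => mahlerMeasure_le_integral_normOnCircle (P i)) hup
  · have hm : MeasureTheory.TendstoInMeasure AddCircle.haarAddCircle
        (fun i t => normOnCircle (P i) t - 1) l (fun _ => (0 : ℝ)) := by
      refine MeasureTheory.tendstoInMeasure_of_tendsto_eLpNorm hα (fun i => ?_) ?_ ?_
      · exact ((continuous_normOnCircle (P i)).sub continuous_const).aestronglyMeasurable
      · exact MeasureTheory.aestronglyMeasurable_const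
      · refine h.congr fun i => ?_
        congr 1
        ext t
        simp [normOnCircle]
    rw [MeasureTheory.tendstoInMeasure_iff_norm] at hm
    refine tendsto_order.2 ⟨fun a ha => ?_, fun a ha => Filter.Eventually.of_forall fun i =>
      (hup i).trans_lt ha⟩
    have hε : 0 < (1 - a) / 2 := by linarith
    have h1 := (ENNReal.tendsto_toReal ENNReal.zero_ne_top).comp (hm _ hε)
    simp only [sub_zero] at h1
    have h2 := (tendsto_order.1 h1).2 ((1 - a) / 2) (by simpa using hε)
    filter_upwards [h2] with i hi
    have h3 := one_sub_le_integral_normOnCircle (P i) hε.le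
    have h4 : AddCircle.haarAddCircle.real {t | (1 - a) / 2 ≤ ‖normOnCircle (P i) t - 1‖} <
      (1 - a) / 2 := hi
    linarith

/-- If the `L²` norm is at most `1`, then `|P|²` is close to `1` in `L¹` as soon as the `L¹` norm of
`P` is close to `1`. -/
lemma integral_abs_normOnCircle_sq_sub_one_le {P : Polynomial ℂ}
    (hP : ∫ t, normOnCircle P t ^ 2 ∂AddCircle.haarAddCircle ≤ 1) {s : ℝ} (hs : 0 < s) :
    ∫ t, |normOnCircle P t ^ 2 - 1| ∂AddCircle.haarAddCircle ≤
      (1 - ∫ t, normOnCircle P t ∂AddCircle.haarAddCircle) / s + 2 * s := by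
  have hc := continuous_normOnCircle P
  have i1 := integrable_of_continuous_addCircle hc
  have i2 : MeasureTheory.Integrable (fun t => normOnCircle P t ^ 2) AddCircle.haarAddCircle :=
    integrable_of_continuous_addCircle (hc.pow 2)
  have i3 : MeasureTheory.Integrable (fun t => -(1 / s) * normOnCircle P t + (1 / (2 * s) + s))
      AddCircle.haarAddCircle := (i1.const_mul _).add (MeasureTheory.integrable_const _)
  -- `|f² - 1| = |f - 1| |f + 1|`, by the weighted inequality of the means with weight `s`
  have hpt : ∀ t, |normOnCircle P t ^ 2 - 1| ≤
      (1 / (2 * s) + s) * normOnCircle P t ^ 2 + (-(1 / s) * normOnCircle P t +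
        (1 / (2 * s) + s)) := by
    intro t
    set f := normOnCircle P t
    have h1 : |f ^ 2 - 1| = |f - 1| * |f + 1| := by rw [← abs_mul]; ring_nf
    have h2 : |f - 1| * |f + 1| ≤ (f - 1) ^ 2 / (2 * s) + s * (f + 1) ^ 2 / 2 := by
      have h3 : (f - 1) ^ 2 / (2 * s) + s * (f + 1) ^ 2 / 2 - |f - 1| * |f + 1| =
          (|f - 1| - s * |f + 1|) ^ 2 / (2 * s) := by
        rw [← sq_abs (f - 1), ← sq_abs (f + 1)]; field_simp; ring
      have h4 : 0 ≤ (|f - 1| - s * |f + 1|) ^ 2 / (2 * s) := by positivity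
      linarith
    have h5 : s * (f + 1) ^ 2 / 2 ≤ s * (f ^ 2 + 1) := by nlinarith [sq_nonneg (f - 1)]
    have h6 : (f - 1) ^ 2 / (2 * s) = 1 / (2 * s) * f ^ 2 + (-(1 / s) * f + 1 / (2 * s)) := by
      field_simp; ring
    rw [h1]; linarith
  have h := MeasureTheory.integral_mono
    (integrable_of_continuous_addCircle ((hc.pow 2).sub continuous_const).abs)
    ((i2.const_mul _).add i3) hpt
  refine h.trans ?_
  simp only [Pi.add_apply]
  rw [MeasureTheory.integral_add (i2.const_mul _) i3,
    MeasureTheory.integral_add (i1.const_mul _) (MeasureTheory.integrable_const _),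
    MeasureTheory.integral_const_mul, MeasureTheory.integral_const_mul]
  simp only [MeasureTheory.integral_const, MeasureTheory.probReal_univ, one_smul]
  have hk : 0 ≤ 1 / (2 * s) + s := by positivity
  have := mul_le_mul_of_nonneg_left hP hk
  have e : (1 - ∫ t, normOnCircle P t ∂AddCircle.haarAddCircle) / s + 2 * s =
      (1 / (2 * s) + s) * 1 + (-(1 / s) * (∫ t, normOnCircle P t ∂AddCircle.haarAddCircle) +
        (1 / (2 * s) + s)) := by field_simp; ring
  rw [e]; linarith

/-- An integral over the circle, folded to a single arc of length `1 / n`. -/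
lemma le_integral_of_le_sum_translates {n : ℕ} (hn : 0 < n) {k : ℝ → ℝ} (hk : Continuous k)
    (hk0 : ∀ x, 0 ≤ k x) {c : ℝ}
    (h : ∀ θ : ℝ, 1 / 4 ≤ θ → θ ≤ 3 / 4 → n * c ≤ ∑ j ∈ Finset.range n, k ((θ + j) / n)) :
    c / 2 ≤ ∫ x in (0 : ℝ)..1, k x := by
  have hn0 : (n : ℝ) ≠ 0 := by exact_mod_cast hn.ne'
  have hnpos : (0 : ℝ) < n := by exact_mod_cast hn
  let S : ℝ → ℝ := fun θ => ∑ j ∈ Finset.range n, k ((θ + j) / n)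
  have hScont : Continuous S := by fun_prop
  have h1 : ∫ x in (0 : ℝ)..1, k x = (n : ℝ)⁻¹ * ∫ y in (0 : ℝ)..n, k (y / n) := by
    rw [intervalIntegral.integral_comp_div _ hn0, zero_div, div_self hn0, smul_eq_mul,
      inv_mul_cancel_left₀ hn0]
  have h2 : ∫ y in (0 : ℝ)..n, k (y / n) = ∫ θ in (0 : ℝ)..1, S θ := by
    have h3 := intervalIntegral.sum_integral_adjacent_intervals (μ := MeasureTheory.volume)
      (f := fun y => k (y / n)) (a := fun j : ℕ => (j : ℝ)) (n := n)
      (fun j _ => (by fun_prop : Continuous fun y : ℝ => k (y / n)).intervalIntegrable _ _)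
    rw [Nat.cast_zero] at h3
    rw [← h3]
    simp only [S]
    rw [intervalIntegral.integral_finsetSum (f := fun (j : ℕ) (θ : ℝ) => k ((θ + j) / n))
      (fun j _ => (by fun_prop : Continuous fun θ : ℝ => k ((θ + j) / n)).intervalIntegrable _ _)]
    refine Finset.sum_congr rfl fun j _ => ?_
    rw [intervalIntegral.integral_comp_add_right (fun y => k (y / n)) (j : ℝ)]
    congr 1
    · simp
    · push_cast; ring
  have h4 : ∫ θ in (1 / 4 : ℝ)..(3 / 4), S θ ≤ ∫ θ in (0 : ℝ)..1, S θ := by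
    refine intervalIntegral.integral_mono_interval (by norm_num) (by norm_num) (by norm_num)
      (Filter.Eventually.of_forall fun θ => Finset.sum_nonneg fun j _ => hk0 _)
      (hScont.intervalIntegrable _ _)
  have h5 : ∫ θ in (1 / 4 : ℝ)..(3 / 4), (n * c : ℝ) ≤ ∫ θ in (1 / 4 : ℝ)..(3 / 4), S θ :=
    intervalIntegral.integral_mono_on (by norm_num) (by simp) (hScont.intervalIntegrable _ _)
      fun θ hθ => h θ hθ.1 hθ.2
  rw [intervalIntegral.integral_const, smul_eq_mul] at h5
  rw [h1, h2]
  calc c / 2 = (n : ℝ)⁻¹ * ((3 / 4 - 1 / 4) * (n * c)) := by field_simp; ring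
    _ ≤ _ := by gcongr; exact h5.trans h4

end CircleMoments

/-! ### Fekete polynomials are not flat -/

section Fekete

lemma norm_legendreC_le_one (p : Nat.Primes) (a : ℤ) : ‖legendreC p a‖ ≤ 1 := by
  have : Fact (p : ℕ).Prime := ⟨p.2⟩
  rw [legendreC_eq_quadraticChar, Complex.norm_intCast]
  exact_mod_cast abs_quadraticChar_le_one (a : ZMod p)

lemma coeff_shiftedFekete (p : Nat.Primes) (t : ℤ) (n : ℕ) :
    (shiftedFekete p t).coeff n = if n < p then legendreC p ((n : ℤ) + t) else 0 := by
  simp [shiftedFekete, Polynomial.finsetSum_coeff, Polynomial.coeff_X_pow]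

lemma fekete_eq_shiftedFekete (p : Nat.Primes) : fekete p = shiftedFekete p 0 := by
  have : Fact (p : ℕ).Prime := ⟨p.2⟩
  rw [shiftedFekete, Finset.sum_range_eq_add_Ico _ p.2.pos, fekete]
  simp [legendreC_eq_quadraticChar]

lemma norm_eval_normalizeSqrt (p : Nat.Primes) (P : Polynomial ℂ) (z : ℂ) :
    ‖(normalizeSqrt p P).eval z‖ = (Real.sqrt (p : ℕ))⁻¹ * ‖P.eval z‖ := by
  rw [normalizeSqrt, Polynomial.eval_mul, Polynomial.eval_C, norm_mul, Complex.norm_real,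
    Real.norm_of_nonneg (by positivity)]

lemma norm_sq_eval_normalizeSqrt (p : Nat.Primes) (P : Polynomial ℂ) (z : ℂ) :
    ‖(normalizeSqrt p P).eval z‖ ^ 2 = ‖P.eval z‖ ^ 2 / (p : ℕ) := by
  rw [norm_eval_normalizeSqrt, mul_pow, inv_pow, Real.sq_sqrt (Nat.cast_nonneg _), inv_mul_eq_div]

lemma integral_normOnCircle_normalizeSqrt_sq_le (p : Nat.Primes) {P : Polynomial ℂ}
    (hdeg : ∀ n, (p : ℕ) ≤ n → P.coeff n = 0) (hcoeff : ∀ n, ‖P.coeff n‖ ≤ 1) :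
    ∫ t, normOnCircle (normalizeSqrt p P) t ^ 2 ∂AddCircle.haarAddCircle ≤ 1 := by
  have hp : (0 : ℝ) < (p : ℕ) := by exact_mod_cast p.2.pos
  have h : ∀ t, normOnCircle (normalizeSqrt p P) t ^ 2 = normOnCircle P t ^ 2 / (p : ℕ) := fun t =>
    norm_sq_eval_normalizeSqrt p P _
  simp only [h]
  rw [MeasureTheory.integral_div, integral_normOnCircle_sq, div_le_one hp]
  have hsub : P.support ⊆ Finset.range p := by
    intro n hn
    rw [Finset.mem_range]
    by_contra hlt
    exact (Polynomial.mem_support_iff.1 hn) (hdeg n (not_lt.1 hlt))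
  calc ∑ i ∈ P.support, ‖P.coeff i‖ ^ 2 ≤ ∑ i ∈ P.support, (1 : ℝ) :=
        Finset.sum_le_sum fun i _ => pow_le_one₀ (norm_nonneg _) (hcoeff i)
    _ ≤ (p : ℕ) := by
        rw [Finset.sum_const, nsmul_eq_mul, mul_one]
        exact_mod_cast (Finset.card_le_card hsub).trans (Finset.card_range _).le

lemma integral_normOnCircle_shiftedFekete_sq_le (p : Nat.Primes) (t : ℤ) :
    ∫ x, normOnCircle (normalizeSqrt p (shiftedFekete p t)) x ^ 2 ∂AddCircle.haarAddCircle ≤ 1 := by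
  refine integral_normOnCircle_normalizeSqrt_sq_le p (fun n hn => ?_) fun n => ?_
  · rw [coeff_shiftedFekete, if_neg (not_lt.2 hn)]
  · rw [coeff_shiftedFekete]
    split_ifs
    · exact norm_legendreC_le_one _ _
    · simp

lemma integral_normOnCircle_modifiedFekete_sq_le (p : Nat.Primes) :
    ∫ x, normOnCircle (normalizeSqrt p (modifiedFekete p)) x ^ 2 ∂AddCircle.haarAddCircle ≤ 1 := by
  have : Fact (p : ℕ).Prime := ⟨p.2⟩
  refine integral_normOnCircle_normalizeSqrt_sq_le p (fun n hn => ?_) fun n => ?_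
  · rw [modifiedFekete, fekete_eq_shiftedFekete, Polynomial.coeff_add, coeff_shiftedFekete,
      if_neg (not_lt.2 hn), Polynomial.coeff_one, if_neg (by have := p.2.pos; omega), add_zero]
  · rw [modifiedFekete, fekete_eq_shiftedFekete, Polynomial.coeff_add, coeff_shiftedFekete,
      Polynomial.coeff_one]
    rcases Nat.eq_zero_or_pos n with rfl | hn
    · simp [p.2.pos, legendreC_eq_quadraticChar]
    · rw [if_neg hn.ne', zero_add]
      split_ifs
      · exact norm_legendreC_le_one _ _
      · simp

/-- The squared modulus stays away from `1` in `L¹`, uniformly in the shift. -/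
lemma exists_le_integral_abs_shiftedFekete :
    ∃ N : ℕ, ∀ p : Nat.Primes, N ≤ (p : ℕ) → ∀ t : ℤ, 1 / 320 ≤
      ∫ x, |normOnCircle (normalizeSqrt p (shiftedFekete p t)) x ^ 2 - 1|
        ∂AddCircle.haarAddCircle := by
  obtain ⟨N, hN⟩ := exists_le_sum_abs_shiftedFekete
  refine ⟨N, fun p hp t => ?_⟩
  set k : ℝ → ℝ := fun x => |‖(shiftedFekete p t).eval (unitExp x)‖ ^ 2 / (p : ℕ) - 1| with hk
  have hcont : Continuous k := by
    have hu : Continuous unitExp := by unfold unitExp; fun_prop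
    have he := ((shiftedFekete p t).continuous.comp hu).norm
    exact (((he.pow 2).div_const _).sub continuous_const).abs
  have h1 : ∫ x, |normOnCircle (normalizeSqrt p (shiftedFekete p t)) x ^ 2 - 1|
      ∂AddCircle.haarAddCircle = ∫ x in (0 : ℝ)..1, k x := by
    rw [hk, ← integral_haarAddCircle_eq_intervalIntegral fun z =>
      |‖(shiftedFekete p t).eval z‖ ^ 2 / (p : ℕ) - 1|]
    simp only [normOnCircle, norm_sq_eval_normalizeSqrt]
  rw [h1]
  have h2 := le_integral_of_le_sum_translates (c := 1 / 160) p.2.pos hcont (fun x => abs_nonneg _)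
    fun θ hθ hθ' => by
      rw [mul_one_div]
      exact hN p hp t θ hθ hθ'
  linarith

lemma tendsto_primesAtTop : Filter.Tendsto (fun p : Nat.Primes => (p : ℕ)) primesAtTop
    Filter.atTop := Filter.tendsto_comap

instance primesAtTop_neBot : primesAtTop.NeBot := by
  refine Filter.comap_neBot fun s hs => ?_
  obtain ⟨N, hN⟩ := Filter.mem_atTop_sets.1 hs
  obtain ⟨p, hp, hprime⟩ := Nat.exists_infinite_primes N
  exact ⟨⟨p, hprime⟩, hN p hp⟩

/-- The `L¹` norms of the normalized shifted Fekete polynomials do not converge to `1`. -/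
lemma not_tendsto_integral_shiftedFekete (t : Nat.Primes → ℤ) :
    ¬ Filter.Tendsto (fun p => ∫ x, normOnCircle (normalizeSqrt p (shiftedFekete p (t p))) x
      ∂AddCircle.haarAddCircle) primesAtTop (nhds 1) := by
  intro h
  obtain ⟨N, hN⟩ := exists_le_integral_abs_shiftedFekete
  -- the limit of the upper bound with `s = 1 / 1280` is `2 * s = 1 / 640 < 1 / 320`
  have hlim := ((tendsto_const_nhds (x := (1 : ℝ))).sub h).div_const (1 / 1280 : ℝ)
  have hlim' := hlim.add_const (2 * (1 / 1280) : ℝ)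
  have hge : (1 / 320 : ℝ) ≤ (1 - 1) / (1 / 1280) + 2 * (1 / 1280) := by
    refine ge_of_tendsto hlim' ?_
    filter_upwards [tendsto_primesAtTop.eventually_ge_atTop N] with p hp
    exact (hN p hp (t p)).trans (integral_abs_normOnCircle_sq_sub_one_le
      (integral_normOnCircle_shiftedFekete_sq_le p (t p)) (by norm_num))
  norm_num at hge

lemma abs_integral_modifiedFekete_sub_le (p : Nat.Primes) :
    |(∫ x, normOnCircle (normalizeSqrt p (modifiedFekete p)) x ∂AddCircle.haarAddCircle) -
      ∫ x, normOnCircle (normalizeSqrt p (fekete p)) x ∂AddCircle.haarAddCircle| ≤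
      (Real.sqrt (p : ℕ))⁻¹ := by
  have hi := fun P : Polynomial ℂ =>
    integrable_of_continuous_addCircle (continuous_normOnCircle P)
  rw [← MeasureTheory.integral_sub (hi _) (hi _), ← Real.norm_eq_abs]
  have h := MeasureTheory.norm_integral_le_of_norm_le_const
    (μ := AddCircle.haarAddCircle) (C := (Real.sqrt (p : ℕ))⁻¹)
    (f := fun x : AddCircle (1 : ℝ) => normOnCircle (normalizeSqrt p (modifiedFekete p)) x -
      normOnCircle (normalizeSqrt p (fekete p)) x)
    (Filter.Eventually.of_forall fun x => ?_)
  · simpa using h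
  · simp only [normOnCircle, norm_eval_normalizeSqrt]
    rw [← mul_sub, norm_mul, Real.norm_of_nonneg (by positivity)]
    refine mul_le_of_le_one_right (by positivity) ((abs_norm_sub_norm_le _ _).trans ?_)
    simp [modifiedFekete]

end Fekete

theorem theoremA1 (α : ℝ≥0∞) :
    ¬ IsFlat primesAtTop α (fun p => normalizeSqrt p (fekete p)) ∧
    ¬ IsFlat primesAtTop α (fun p => normalizeSqrt p (modifiedFekete p)) ∧
    ∀ t : Nat.Primes → ℤ,
      ¬ IsFlat primesAtTop α (fun p => normalizeSqrt p (shiftedFekete p (t p))) := by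
  have hshift : ∀ t : Nat.Primes → ℤ,
      ¬ IsFlat primesAtTop α (fun p => normalizeSqrt p (shiftedFekete p (t p))) := fun t h =>
    not_tendsto_integral_shiftedFekete t (h.tendsto_integral_normOnCircle
      fun p => integral_normOnCircle_shiftedFekete_sq_le p (t p))
  refine ⟨?_, fun h => ?_, hshift⟩
  · simp only [fekete_eq_shiftedFekete]
    exact hshift fun _ => 0
  · have h1 := h.tendsto_integral_normOnCircle integral_normOnCircle_modifiedFekete_sq_le
    have h2 : Filter.Tendsto (fun p : Nat.Primes => (Real.sqrt (p : ℕ))⁻¹) primesAtTop (nhds 0) :=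
      tendsto_inv_atTop_zero.comp (Real.tendsto_sqrt_atTop.comp
        (tendsto_natCast_atTop_atTop.comp tendsto_primesAtTop))
    have h3 := h1.sub (squeeze_zero_norm abs_integral_modifiedFekete_sub_le h2)
    simp only [sub_sub_cancel, sub_zero, fekete_eq_shiftedFekete] at h3
    exact not_tendsto_integral_shiftedFekete (fun _ => 0) h3
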